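/- Let $F$ be a field of characteristic different from $2$, let $\Gamma_F=\operatorname{Gal}(F_{\mathrm{sep}}/F)$ be its absolute Galois group, and let $a,b,c,d\in F^\times$. For $u\in F^\times$ let $\chi_u\in H^1(F,\mathbb Z/2\mathbb Z)=\operatorname{Hom}_{\mathrm{cont}}(\Gamma_F,\mathbb Z/2\mathbb Z)$ be the Kummer character of $u$, i.e. $g(u')=(-1)^{\chi_u(g)}u'$ for all $g\in\Gamma_F$ and $u'\in F_{\mathrm{sep}}$ with $u'^2=u$. The mod $2$ Massey product $\langle a,b,c,d\rangle\subseteq H^2(F,\mathbb Z/2\mathbb Z)$ is the Massey product of $\chi_1=\chi_a$, $\chi_2=\chi_b$, $\chi_3=\chi_c$, $\chi_4=\chi_d$ in the DGA $C^\bullet(\Gamma_F,\mathbb Z/2\mathbb Z)$ of continuous inhomogeneous cochains with the cup product: a defining system is a family $M=(a_{ij})$ of elements of $C^1(\Gamma_F,\mathbb Z/2\mathbb Z)$, for $1\le i<j\le 5$, $(i,j)\neq(1,5)$, such that each $a_{i,i+1}$ is a cocycle representing $\chi_i$ and $\partial(a_{ij})=\sum_{l=i+1}^{j-1}a_{il}a_{lj}$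 whenever $i<j-1$; and $\langle a,b,c,d\rangle$ is the set of the cohomology classes of the $2$-cocycles $\sum_{l=2}^{4}a_{1l}a_{l5}$ for all defining systems $M$. It is said to be defined if it is non-empty. For $u,v\in F^\times$ let $F_u=F[x_u]/(x_u^2-u)$ and $F_{u,v}=F_{v,u}=F[x_u,x_v]/(x_u^2-u,\,x_v^2-v)$, and put $\sqrt u=x_u$, $\sqrt v=x_v$ (if $u=v$, the variables $x_u$ and $x_v$ are still distinct). Let $N_{u,v}\colon F_{u,v}^\times\to F^\times$ be the norm of $F_{u,v}/F$, let $N_u\colon F_{u,v}^\times\to F_v^\times$ be the norm of $F_{u,v}=(F_v)_u$ over $F_v$, and let $\sigma_u$ be the $F$-automorphism of $F_{u,v}$ with $\sigma_u(\sqrt u)=-\sqrt u$ and $\sigma_u(\sqrt v)=\sqrt v$; similarly for $v$. For $\omega \in F_{u,v}^\times$ write $(\sigma_u-1)\omega=\sigma_u(\omega)/\omega$, and similarly for $\sigma_v$. Then the Massey product $\langle a,b,c,d\rangle$ is defined if and only if there exist $\epsilon\in F_{a,c}^\times$, $\nu\in F_{b,d}^\times$ and $\omega\in F_{b,c}^\times$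 such that 1. $N_{a,c}(\epsilon)=b$ in $F^\times/F^{\times2}$; 2. $N_{b,d}(\nu)=c$ in $F^\times/F^{\times2}$; 3. $N_a(\epsilon)\,N_d(\nu)=\omega^2$ in $F_{b,c}$, where $N_a(\epsilon)\in F_c^\times$ and $N_d(\nu)\in F_b^\times$ are viewed in $F_{b,c}^\times$ through the inclusions $F_c,F_b\subseteq F_{b,c}$; 4. $(\sigma_b-1)(\sigma_c-1)\omega=-1$. -/

import Mathlib

/-! ## Mod 2 continuous cochains of a topological group and Massey products -/

namespace MasseyProd

section Cochains

/-- Continuous inhomogeneous `n`-cochains of `Γ` with coefficients in the discrete trivial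
module `ℤ/2`. -/
abbrev Cochain (Γ : Type*) [TopologicalSpace Γ] (n : ℕ) : Type _ := C(Fin n → Γ, ZMod 2)

variable {Γ : Type*} [Group Γ] [TopologicalSpace Γ]

theorem continuous_contractNth [ContinuousMul Γ] {n : ℕ} (j : Fin (n + 1)) :
    Continuous (fun g : Fin (n + 1) → Γ => Fin.contractNth j (· * ·) g) := by
  refine continuous_pi fun k => ?_
  unfold Fin.contractNth
  split_ifs <;> fun_prop

/-- The differential of inhomogeneous cochains,
`(∂f)(g₀,…,gₙ) = f(g₁,…,gₙ) + ∑_{j<n} f(…,g_j g_{j+1},…) + f(g₀,…,g_{n-1})`.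
The term `j = n` of the sum over `Fin (n + 1)` is the last summand. The usual signs and the
action of `g₀` are absent because the coefficients are the trivial module `ℤ/2`. -/
def d [ContinuousMul Γ] (n : ℕ) : Cochain Γ n →+ Cochain Γ (n + 1) where
  toFun f :=
    { toFun := fun g => f (fun i => g i.succ) +
        ∑ j : Fin (n + 1), f (Fin.contractNth j (· * ·) g)
      continuous_toFun := by
        have h1 : Continuous fun g : Fin (n + 1) → Γ => f (fun i => g i.succ) :=
          f.continuous.comp (by fun_prop)
        have h2 : Continuous fun g : Fin (n + 1) → Γ =>
            ∑ j : Fin (n + 1), f (Fin.contractNth j (· * ·) g) :=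
          continuous_finsetSum _ fun j _ => f.continuous.comp (continuous_contractNth j)
        exact h1.add h2 }
  map_zero' := by ext; simp
  map_add' f f' := by
    ext g
    simp only [ContinuousMap.coe_mk, ContinuousMap.add_apply, Finset.sum_add_distrib]
    ring

/-- The cup product of cochains,
`(f ⌣ f')(g₁,…,g_{p+q}) = f(g₁,…,g_p) f'(g_{p+1},…,g_{p+q})`. -/
def cup {p q : ℕ} (f : Cochain Γ p) (f' : Cochain Γ q) : Cochain Γ (p + q) where
  toFun g := f (fun i => g (Fin.castAdd q i)) * f' (fun i => g (Fin.natAdd p i))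
  continuous_toFun :=
    (f.continuous.comp (by fun_prop)).mul (f'.continuous.comp (by fun_prop))

variable (Γ) in
/-- Continuous `n`-cocycles. -/
def cocycles [ContinuousMul Γ] (n : ℕ) : AddSubgroup (Cochain Γ n) := (d n).ker

variable (Γ) in
/-- Continuous `n`-coboundaries. -/
def coboundaries [ContinuousMul Γ] : (n : ℕ) → AddSubgroup (Cochain Γ n)
  | 0 => ⊥
  | n + 1 => (d n).range

variable (Γ) in
/-- Continuous cohomology `Hⁿ(Γ, ℤ/2)`: cocycles modulo coboundaries. -/
abbrev H [ContinuousMul Γ] (n : ℕ) : Type _ :=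
  cocycles Γ n ⧸ (coboundaries Γ n).addSubgroupOf (cocycles Γ n)

/-- The cohomology class of a cocycle. -/
def cls [ContinuousMul Γ] {n : ℕ} (f : cocycles Γ n) : H Γ n := QuotientAddGroup.mk f

/-- `M = (M i j)` is a defining system for the Massey product `⟨χ₁,…,χₙ⟩`, with matrix indices
running through `0,…,n` in place of `1,…,n+1`. Only the entries `M i j` with `i < j` and
`(i, j) ≠ (0, n)` matter. -/
structure IsDefiningSystem [ContinuousMul Γ] {n : ℕ} (χ : Fin n → H Γ 1)
    (M : Fin (n + 1) → Fin (n + 1) → Cochain Γ 1) : Prop where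
  represents : ∀ i : Fin n, ∃ h : M i.castSucc i.succ ∈ cocycles Γ 1, cls ⟨_, h⟩ = χ i
  differential : ∀ i j : Fin (n + 1), (i : ℕ) + 1 < j → ¬ (i = 0 ∧ j = Fin.last n) →
    d 1 (M i j) = ∑ l ∈ Finset.Ioo i j, cup (M i l) (M l j)

/-- The 2-cochain `∑ M 0 l ⌣ M l n`, over `0 < l < n`, attached to a system `M`. -/
def masseyValue {n : ℕ} (M : Fin (n + 1) → Fin (n + 1) → Cochain Γ 1) : Cochain Γ 2 :=
  ∑ l ∈ Finset.Ioo 0 (Fin.last n), cup (M 0 l) (M l (Fin.last n))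

theorem d_one_apply [ContinuousMul Γ] (f : Cochain Γ 1) (g : Fin 2 → Γ) :
    d 1 f g = f ![g 1] + f ![g 0 * g 1] + f ![g 0] := by
  have e0 : (fun i : Fin 1 => g i.succ) = ![g 1] := by
    funext i; fin_cases i; rfl
  have e1 : Fin.contractNth (0 : Fin 2) (· * ·) g = ![g 0 * g 1] := by
    funext i; fin_cases i; rfl
  have e2 : Fin.contractNth (1 : Fin 2) (· * ·) g = ![g 0] := by
    funext i; fin_cases i; rfl
  change f _ + ∑ j : Fin 2, f (Fin.contractNth j (· * ·) g) = _
  rw [Fin.sum_univ_two, e0, e1, e2, add_assoc]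

theorem d_two_apply [ContinuousMul Γ] (f : Cochain Γ 2) (g : Fin 3 → Γ) :
    d 2 f g = f ![g 1, g 2] + f ![g 0 * g 1, g 2] + f ![g 0, g 1 * g 2] + f ![g 0, g 1] := by
  have e0 : (fun i : Fin 2 => g i.succ) = ![g 1, g 2] := by
    funext i; fin_cases i <;> rfl
  have e1 : Fin.contractNth (0 : Fin 3) (· * ·) g = ![g 0 * g 1, g 2] := by
    funext i; fin_cases i <;> rfl
  have e2 : Fin.contractNth (1 : Fin 3) (· * ·) g = ![g 0, g 1 * g 2] := by
    funext i; fin_cases i <;> rfl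
  have e3 : Fin.contractNth (2 : Fin 3) (· * ·) g = ![g 0, g 1] := by
    funext i; fin_cases i <;> rfl
  change f _ + ∑ j : Fin 3, f (Fin.contractNth j (· * ·) g) = _
  rw [Fin.sum_univ_three, e0, e1, e2, e3]
  ring

theorem cup_one_one_apply {Γ : Type*} [TopologicalSpace Γ] (f f' : Cochain Γ 1)
    (g : Fin 2 → Γ) :
    cup f f' g = f ![g 0] * f' ![g 1] := by
  simp only [cup, ContinuousMap.coe_mk]
  congr 2 <;> ext i <;> fin_cases i <;> rfl

theorem d_cup_one_one [ContinuousMul Γ] (f f' : Cochain Γ 1) (g : Fin 3 → Γ) :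
    d 2 (cup f f' : Cochain Γ 2) g =
      d 1 f ![g 0, g 1] * f' ![g 2] + f ![g 0] * d 1 f' ![g 1, g 2] := by
  have h2 : ∀ z : ZMod 2, z + z = 0 := by decide
  simp only [d_two_apply, d_one_apply, cup_one_one_apply]
  simp only [Matrix.cons_val_zero, Matrix.cons_val_one]
  linear_combination (-1 : ZMod 2) * h2 (f ![g 0] * f' ![g 2])

theorem IsDefiningSystem.differential' [ContinuousMul Γ] {n : ℕ} {χ : Fin n → H Γ 1}
    {M : Fin (n + 1) → Fin (n + 1) → Cochain Γ 1} (hM : IsDefiningSystem χ M)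
    (i j : Fin (n + 1)) (hij : i < j) (h : ¬ (i = 0 ∧ j = Fin.last n)) :
    d 1 (M i j) = ∑ l ∈ Finset.Ioo i j, cup (M i l) (M l j) := by
  rcases Nat.lt_or_ge ((i : ℕ) + 1) j with h1 | h1
  · exact hM.differential i j h1 h
  · have hj : (j : ℕ) = i + 1 := by have : (i : ℕ) < j := hij; omega
    have hi : (i : ℕ) < n := by have := j.2; omega
    obtain ⟨hc, -⟩ := hM.represents ⟨i, hi⟩
    have e1 : (⟨i, hi⟩ : Fin n).castSucc = i := rfl
    have e2 : (⟨i, hi⟩ : Fin n).succ = j := Fin.ext hj.symm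
    rw [e1, e2] at hc
    have hz : d 1 (M i j) = 0 := hc
    rw [hz, Finset.sum_eq_zero]
    intro l hl
    have hl' := Finset.mem_Ioo.1 hl
    have h3 : (i : ℕ) < l := hl'.1
    have h4 : (l : ℕ) < j := hl'.2
    omega

theorem IsDefiningSystem.masseyValue_mem [ContinuousMul Γ] {n : ℕ}
    {χ : Fin n → H Γ 1} {M : Fin (n + 1) → Fin (n + 1) → Cochain Γ 1}
    (hM : IsDefiningSystem χ M) : masseyValue M ∈ cocycles Γ 2 := by
  have h2 : ∀ z : ZMod 2, z + z = 0 := by decide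
  change d 2 (masseyValue M) = 0
  ext g
  have hsum : ∀ (s : Finset (Fin (n + 1))) (f : Fin (n + 1) → Cochain Γ 2) (x : Fin 2 → Γ),
      (∑ l ∈ s, f l) x = ∑ l ∈ s, f l x := fun s f x => by
    simp [ContinuousMap.sum_apply]
  rw [masseyValue, map_sum, ContinuousMap.sum_apply]
  have key : ∀ l ∈ Finset.Ioo 0 (Fin.last n),
      d 2 (cup (M 0 l) (M l (Fin.last n)) : Cochain Γ 2) g =
      (∑ k ∈ Finset.Ioo 0 l, M 0 k ![g 0] * M k l ![g 1] * M l (Fin.last n) ![g 2]) +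
      ∑ k ∈ Finset.Ioo l (Fin.last n),
        M 0 l ![g 0] * M l k ![g 1] * M k (Fin.last n) ![g 2] := by
    intro l hl
    obtain ⟨hl0, hl1⟩ := Finset.mem_Ioo.1 hl
    rw [d_cup_one_one, hM.differential' 0 l hl0 (fun h => hl1.ne h.2),
      hM.differential' l _ hl1 (fun h => hl0.ne' h.1), hsum, hsum, Finset.sum_mul, Finset.mul_sum]
    simp only [cup_one_one_apply, Matrix.cons_val_zero, Matrix.cons_val_one, mul_assoc]
  rw [Finset.sum_congr rfl key, Finset.sum_add_distrib]
  rw [Finset.sum_comm' (s := Finset.Ioo 0 (Fin.last n)) (t := fun l => Finset.Ioo 0 l)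
    (t' := Finset.Ioo 0 (Fin.last n)) (s' := fun k => Finset.Ioo k (Fin.last n))]
  · exact h2 _
  · intro x y
    simp only [Finset.mem_Ioo]
    constructor
    · rintro ⟨⟨h1, h3⟩, h4, h5⟩
      exact ⟨⟨h5, h3⟩, h4, h5.trans h3⟩
    · rintro ⟨⟨h1, h3⟩, h4, h5⟩
      exact ⟨⟨h4.trans h1, h3⟩, h4, h1⟩

/-- The Massey product `⟨χ₁,…,χₙ⟩ ⊆ H²(Γ, ℤ/2)` (meaningful for `n ≥ 2`): the set of classes of the cocycles
`masseyValue M`, for all defining systems `M`. -/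
def masseyProduct [ContinuousMul Γ] {n : ℕ} (χ : Fin n → H Γ 1) : Set (H Γ 2) :=
  {x | ∃ (M : Fin (n + 1) → Fin (n + 1) → Cochain Γ 1) (hM : IsDefiningSystem χ M),
    x = cls ⟨masseyValue M, hM.masseyValue_mem⟩}

end Cochains

section Kummer

variable (F : Type*) [Field F]

/-- The absolute Galois group of `F`, with the Krull topology. -/
abbrev AbsGal : Type _ := Gal(SeparableClosure F/F)

variable {F}

open Classical in
/-- The Kummer character of `a ∈ F^×` as a function: `g(s) = (-1)^{χ_a(g)} s` for every square root
`s` of `a` in the separable closure. -/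
noncomputable def kummerFun (a : Fˣ) (g : AbsGal F) : ZMod 2 :=
  if ∀ s : SeparableClosure F, s ^ 2 = algebraMap F _ a → g s = s then 0 else 1

theorem exists_sqrt [NeZero (2 : F)] (a : Fˣ) :
    ∃ s : SeparableClosure F, s ^ 2 = algebraMap F _ (a : F) ∧ s ≠ 0 := by
  have : NeZero (2 : SeparableClosure F) := by
    refine ⟨fun h => NeZero.ne (2 : F) ((algebraMap F (SeparableClosure F)).injective ?_)⟩
    rw [map_ofNat, h, map_zero]
  obtain ⟨z, hz⟩ := IsSepClosed.exists_eq_mul_self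
    (algebraMap F (SeparableClosure F) (a : F))
  refine ⟨z, by rw [hz, sq], fun h => a.ne_zero ?_⟩
  rw [h, zero_mul] at hz
  exact (algebraMap F (SeparableClosure F)).injective (by rw [hz, map_zero])

/-- The value at `g` is read off from the action of `g` on any one square root of `a`. -/
theorem kummerFun_spec [NeZero (2 : F)] (a : Fˣ) (g : AbsGal F) {s : SeparableClosure F}
    (hs : s ^ 2 = algebraMap F _ (a : F)) :
    (kummerFun a g = 0 ∧ g s = s) ∨ (kummerFun a g = 1 ∧ g s = -s ∧ g s ≠ s) := by
  unfold kummerFun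
  split_ifs with h
  · exact Or.inl ⟨rfl, h s hs⟩
  · refine Or.inr ⟨rfl, ?_⟩
    have hne : g s ≠ s := by
      intro hg
      apply h
      intro t ht
      rcases sq_eq_sq_iff_eq_or_eq_neg.1 (ht.trans hs.symm) with rfl | rfl
      · exact hg
      · rw [map_neg, hg]
    refine ⟨?_, hne⟩
    have : (g s) ^ 2 = s ^ 2 := by rw [← map_pow, hs, AlgEquiv.commutes]
    exact (sq_eq_sq_iff_eq_or_eq_neg.1 this).resolve_left hne

theorem kummerFun_mul [NeZero (2 : F)] (a : Fˣ) (g h : AbsGal F) :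
    kummerFun a (g * h) = kummerFun a g + kummerFun a h := by
  obtain ⟨s, hs, -⟩ := exists_sqrt a
  have h11 : (1 : ZMod 2) + 1 = 0 := by decide
  rcases kummerFun_spec a h hs with ⟨e2, f2⟩ | ⟨e2, f2, n2⟩ <;>
  rcases kummerFun_spec a g hs with ⟨e1, f1⟩ | ⟨e1, f1, n1⟩ <;>
  rcases kummerFun_spec a (g * h) hs with ⟨e3, f3⟩ | ⟨e3, f3, n3⟩ <;>
  rw [e1, e2, e3] <;> have e4 : (g * h) s = g (h s) := rfl
  · rw [add_zero]
  · exact absurd (e4.trans (by rw [f2, f1])) n3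
  · exact absurd ((by rw [e4, f2] at f3; exact f3) : g s = s) n1
  · rw [add_zero]
  · rw [e4, f2, map_neg, f1] at f3
    exact absurd (f2.trans f3) n2
  · rw [zero_add]
  · rw [h11]
  · exact absurd (e4.trans (by rw [f2, map_neg, f1, neg_neg])) n3

theorem continuous_kummerFun [NeZero (2 : F)] (a : Fˣ) :
    Continuous (kummerFun a : AbsGal F → ZMod 2) := by
  obtain ⟨s, hs, -⟩ := exists_sqrt a
  have hopen := stabilizer_isOpen_of_isIntegral (K := F) s
  refine (IsLocallyConstant.iff_exists_open _).2 (fun g => ?_) |>.continuous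
  refine ⟨(fun x => g⁻¹ * x) ⁻¹' (MulAction.stabilizer (AbsGal F) s : Set (AbsGal F)),
    hopen.preimage (by fun_prop), by simp, ?_⟩
  intro x hx
  have hx' : (g⁻¹ * x) s = s := hx
  have h0 : kummerFun a (g⁻¹ * x) = 0 := by
    rcases kummerFun_spec a (g⁻¹ * x) hs with ⟨e, -⟩ | ⟨-, -, n⟩
    · exact e
    · exact absurd hx' n
  have := kummerFun_mul a g (g⁻¹ * x)
  rwa [mul_inv_cancel_left, h0, add_zero] at this

/-- The Kummer character of `a` as a continuous 1-cochain. -/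
noncomputable def kummerCochain [NeZero (2 : F)] (a : Fˣ) : Cochain (AbsGal F) 1 where
  toFun g := kummerFun a (g 0)
  continuous_toFun := (continuous_kummerFun a).comp (by fun_prop)

theorem kummerCochain_mem [NeZero (2 : F)] (a : Fˣ) :
    kummerCochain a ∈ cocycles (AbsGal F) 1 := by
  have h2 : ∀ x y : ZMod 2, y + (x + y) + x = 0 := by decide
  change d 1 _ = 0
  ext g
  rw [d_one_apply]
  change kummerFun a (g 1) + kummerFun a (g 0 * g 1) + kummerFun a (g 0) = 0
  rw [kummerFun_mul, h2]

/-- The class `χ_a ∈ H¹(F, ℤ/2)` of `a ∈ F^×`. -/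
noncomputable def kummerClass [NeZero (2 : F)] (a : Fˣ) : H (AbsGal F) 1 :=
  cls ⟨kummerCochain a, kummerCochain_mem a⟩

/-- The fourfold Massey product `⟨a, b, c, d⟩ ⊆ H²(F, ℤ/2)` of elements of `F^×`. -/
noncomputable def masseyProduct₄ [NeZero (2 : F)] (a b c d : Fˣ) : Set (H (AbsGal F) 2) :=
  masseyProduct ![kummerClass a, kummerClass b, kummerClass c, kummerClass d]

end Kummer

section Quadratic

/-- The quadratic étale algebra `E_a = E[x] / (x² - a)`; the element `√a` is `⟨0, 1⟩`. -/
abbrev Quad {E : Type*} [CommRing E] (a : E) : Type _ := QuadraticAlgebra E a 0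

/-- The `E`-automorphism `√a ↦ -√a` of `E_a`. -/
def conj {E : Type*} [CommRing E] (a : E) : Quad a ≃ₐ[E] Quad a where
  toFun z := ⟨z.re, -z.im⟩
  invFun z := ⟨z.re, -z.im⟩
  left_inv z := by ext <;> simp
  right_inv z := by ext <;> simp
  map_mul' z w := by ext <;> simp; ring
  map_add' z w := by ext <;> simp; ring
  commutes' r := by ext <;> simp

variable {F : Type*} [Field F]

/-- The biquadratic étale algebra `F_{a,c} = F[x_a, x_c] / (x_a² - a, x_c² - c)`, presented as the
quadratic algebra `(F_c)_a` over `F_c`. -/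
abbrev Biquad (a c : F) : Type _ := Quad (algebraMap F (Quad c) a)

theorem algebraMap_biquad (a c r : F) :
    algebraMap F (Biquad a c) r = ⟨⟨r, 0⟩, ⟨0, 0⟩⟩ := rfl

/-- The inclusion `F_c → F_{a,c}`, making `F_{a,c}` an `F_c`-algebra. -/
def inclRight (a c : F) : Quad c →ₐ[F] Biquad a c where
  toFun z := ⟨z, 0⟩
  map_one' := rfl
  map_zero' := rfl
  map_mul' z w := by ext <;> simp
  map_add' z w := by ext <;> simp
  commutes' r := rfl

/-- The inclusion `F_a → F_{a,c}`, `x + y √a ↦ x + y √a`. -/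
def inclLeft (a c : F) : Quad a →ₐ[F] Biquad a c where
  toFun z := ⟨algebraMap F _ z.re, algebraMap F _ z.im⟩
  map_one' := rfl
  map_zero' := rfl
  map_mul' z w := by ext <;> simp
  map_add' z w := by ext <;> simp
  commutes' r := by rw [algebraMap_biquad]; ext <;> simp

/-- The automorphism `σ_a` of `F_{a,c}`: `√a ↦ -√a`, `√c ↦ √c`. -/
def sigmaLeft (a c : F) : Biquad a c ≃ₐ[F] Biquad a c where
  toFun z := ⟨z.re, -z.im⟩
  invFun z := ⟨z.re, -z.im⟩
  left_inv z := by ext <;> simp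
  right_inv z := by ext <;> simp
  map_mul' z w := by ext <;> simp <;> ring
  map_add' z w := by ext <;> simp <;> ring
  commutes' r := by rw [algebraMap_biquad]; ext <;> simp

/-- The automorphism `σ_c` of `F_{a,c}`: `√a ↦ √a`, `√c ↦ -√c`. -/
def sigmaRight (a c : F) : Biquad a c ≃ₐ[F] Biquad a c where
  toFun z := ⟨conj c z.re, conj c z.im⟩
  invFun z := ⟨conj c z.re, conj c z.im⟩
  left_inv z := by ext <;> simp [conj]
  right_inv z := by ext <;> simp [conj]
  map_mul' z w := by ext <;> simp [conj] <;> ring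
  map_add' z w := by ext <;> simp [conj] <;> ring
  commutes' r := by rw [algebraMap_biquad]; ext <;> simp [conj]

/-- The norm `N_{a,c}` of the `F`-algebra `F_{a,c}`, on units. -/
noncomputable def normF (a c : F) : (Biquad a c)ˣ →* Fˣ := Units.map (Algebra.norm F)

/-- The norm `N_a` of the `F_c`-algebra `F_{a,c}`, on units. -/
noncomputable def normLeft (a c : F) : (Biquad a c)ˣ →* (Quad c)ˣ :=
  Units.map (Algebra.norm (Quad c))

/-- The operator `σ - 1` on a multiplicative group of units: `u ↦ σ(u) / u`. -/
def subOne {A : Type*} [CommRing A] [Algebra F A] (σ : A ≃ₐ[F] A) (u : Aˣ) : Aˣ :=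
  Units.map (σ : A →* A) u / u

/-- The class of `u` in `F^× / F^{×2}`. -/
def sqClass (u : Fˣ) : Fˣ ⧸ (powMonoidHom 2 : Fˣ →* Fˣ).range := QuotientGroup.mk u

end Quadratic

end MasseyProd

/-!
A defining system for `⟨a, b, c, d⟩` amounts to two continuous homomorphisms from the Galois group
to the unipotent `4 × 4` matrices over `ℤ/2`, lifting `(χ_a, χ_b, χ_c)` and `(χ_b, χ_c, χ_d)`, that
share the entry `v` with coboundary `χ_b ⌣ χ_c` (`masseyProduct₄_nonempty_iff`).

Unipotent matrices of size 4 are pairs of unipotent `2 × 2` blocks together with an upper right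
`2 × 2` block, and the abelian group of these blocks is the induced module `Map((ℤ/2)², ℤ/2)`, on
which the Galois group acts by translation through the diagonal blocks. Hence a lift of
`(χ_a, χ_b, χ_c)` is a cocycle in the module induced from `F_{a,c}`, and by Shapiro's lemma and
Kummer theory it is given by a unit `ε` of `F_{a,c}` whose norm has the square class of `b`.

This is made explicit through evaluations. An element of `F_{a,c}` is the same as a family of
elements `e(p, q)` of the separable closure, indexed by the signs of `√a` and `√c` and permuted by
the Galois group accordingly (`exists_evalBiquad_eq`). This description does not distinguish the
cases in which `F_{a,c}` fails to be a field. In one direction, Hilbert's theorem 90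
(`exists_family_of_cocycle`) yields a family `r(p, q)` on which the Galois group acts up to the
signs of the cocycle, and `ε = r²`; in the other, the cocycle is read off from square roots of the
`ε(p, q)` (`exists_isUnipotentLift_of_sq`).

The products `R(q) = r(0,q) r(1,q)`, square roots of `N_a(ε)`, and `S(p)`, their analogues for
`N_d(ν)`, are acted on with signs `v + (q + χ_c) χ_b` and `v' + p χ_c`, where `v`, `v'` are the
entries which have to be equal. If `v = v'`, the family `(-1)^{pq} R(q) S(p)` is an element `ω` of
`F_{b,c}` as required. Conversely, if `ω` is given, then `R(q) S(p) = (-1)^{η(p,q)} ω(p, q)`, the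
condition on `(σ_b - 1)(σ_c - 1) ω` forces `η = p q + x p + y q + z`, and so
`v = v' + x χ_b + y χ_c`; the difference is removed by a conjugation
(`IsUnipotentLift.add_characters`).
-/

namespace MasseyProd

/-! ### Signs -/

section Sign

theorem eq_zero_or_one (x : ZMod 2) : x = 0 ∨ x = 1 := by
  revert x; decide

/-- The sign `(-1)^x` of an element `x` of `ℤ/2`. -/
def sgn (R : Type*) [Ring R] (x : ZMod 2) : R := if x = 0 then 1 else -1

variable {R : Type*} [Ring R]

@[simp] theorem sgn_zero : sgn R 0 = 1 := rfl

@[simp] theorem sgn_one : sgn R 1 = -1 := by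
  rw [sgn, if_neg (by decide)]

theorem sgn_add (x y : ZMod 2) : sgn R (x + y) = sgn R x * sgn R y := by
  have h : (1 : ZMod 2) + 1 = 0 := by decide
  rcases eq_zero_or_one x with rfl | rfl <;> rcases eq_zero_or_one y with rfl | rfl <;> simp [h]

theorem sgn_mul_self (x : ZMod 2) : sgn R x * sgn R x = 1 := by
  rcases eq_zero_or_one x with rfl | rfl <;> simp

theorem sgn_sq (x : ZMod 2) : sgn R x ^ 2 = 1 := by rw [sq, sgn_mul_self]

@[simp] theorem map_sgn {R' G : Type*} [Ring R'] [FunLike G R R'] [RingHomClass G R R'] (f : G)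
    (x : ZMod 2) : f (sgn R x) = sgn R' x := by
  unfold sgn; split_ifs <;> simp

variable {K : Type*} [Field K]

theorem sgn_ne_zero (x : ZMod 2) : sgn K x ≠ 0 := fun h => by
  simpa [h] using sgn_sq (R := K) x

theorem sgn_injective [NeZero (2 : K)] : Function.Injective (sgn K) := by
  have h : (1 : K) ≠ -1 := fun h => NeZero.ne (2 : K) (by linear_combination h)
  intro x y
  rcases eq_zero_or_one x with rfl | rfl <;> rcases eq_zero_or_one y with rfl | rfl <;>
    simp [h, h.symm]

theorem exists_eq_sgn_mul_of_sq_eq {x y : K} (h : x ^ 2 = y ^ 2) : ∃ t, x = sgn K t * y := by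
  rcases sq_eq_sq_iff_eq_or_eq_neg.1 h with h | h
  · exact ⟨0, by simp [h]⟩
  · exact ⟨1, by simp [h]⟩

end Sign

/-! ### Evaluating biquadratic algebras in the separable closure -/

section Evaluation

variable {E A : Type*} [CommRing E] [CommRing A]

/-- The extension of a ring homomorphism `f : E → A` to `E_u`, sending `√u` to a square root `t`
of `f u`. -/
def evalQuad (f : E →+* A) {u : E} {t : A} (ht : t ^ 2 = f u) : Quad u →+* A where
  toFun z := f z.re + f z.im * t
  map_one' := by simp [QuadraticAlgebra.re_one, QuadraticAlgebra.im_one]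
  map_zero' := by simp
  map_mul' z w := by
    simp only [QuadraticAlgebra.re_mul, QuadraticAlgebra.im_mul, map_add, map_mul, map_zero]
    linear_combination -(f z.im * f w.im) * ht
  map_add' z w := by
    simp only [QuadraticAlgebra.re_add, QuadraticAlgebra.im_add, map_add]; ring

theorem evalQuad_apply (f : E →+* A) {u : E} {t : A} (ht : t ^ 2 = f u) (z : Quad u) :
    evalQuad f ht z = f z.re + f z.im * t := rfl

/-- The norm of a quadratic algebra is the product of the two evaluations `√u ↦ ±t`. -/
theorem evalQuad_norm (f : E →+* A) {u : E} {t t' : A} (ht : t ^ 2 = f u) (ht' : t' ^ 2 = f u)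
    (h : t' = -t) (z : Quad u) :
    f (Algebra.norm E z) = evalQuad f ht z * evalQuad f ht' z := by
  have h1 : Algebra.norm E z = QuadraticAlgebra.norm z := by
    rw [Algebra.norm_apply, ← QuadraticAlgebra.det_toLinearMap_eq_norm]; rfl
  subst h
  rw [h1, QuadraticAlgebra.norm_def, evalQuad_apply, evalQuad_apply]
  simp
  linear_combination f z.im * f z.im * ht

theorem norm_biquad {F : Type*} [Field F] (u v : F) (z : Biquad u v) :
    Algebra.norm F z = Algebra.norm F (Algebra.norm (Quad v) z) :=
  (Algebra.norm_norm (R := F) (S := Quad v)).symm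

variable {F K : Type*} [Field F] [Field K] [Algebra F K] {u v : F} {s t : K}

theorem sgn_mul_sq {r : K} (hs : s ^ 2 = r) (p : ZMod 2) : (sgn K p * s) ^ 2 = r := by
  rw [mul_pow, sgn_sq, one_mul, hs]

/-- The homomorphism `F_v → K` over `F` with `√v ↦ (-1)^q t`, where `t² = v`. -/
def evalSign (ht : t ^ 2 = algebraMap F K v) (q : ZMod 2) : Quad v →+* K :=
  evalQuad (algebraMap F K) (sgn_mul_sq ht q)

theorem evalSign_algebraMap (ht : t ^ 2 = algebraMap F K v) (q : ZMod 2) (x : F) :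
    evalSign ht q (algebraMap F (Quad v) x) = algebraMap F K x := by
  simp [evalSign, evalQuad_apply]

/-- The homomorphism `F_{u,v} → K` over `F` with `√u ↦ (-1)^p s` and `√v ↦ (-1)^q t`, where
`s² = u` and `t² = v`. -/
def evalBiquad (hs : s ^ 2 = algebraMap F K u) (ht : t ^ 2 = algebraMap F K v) (p q : ZMod 2) :
    Biquad u v →+* K :=
  evalQuad (t := sgn K p * s) (evalSign ht q)
    ((sgn_mul_sq hs p).trans (evalSign_algebraMap ht q u).symm)

variable (hs : s ^ 2 = algebraMap F K u) (ht : t ^ 2 = algebraMap F K v)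

theorem evalBiquad_apply (p q : ZMod 2) (z : Biquad u v) :
    evalBiquad hs ht p q z =
      algebraMap F K z.re.re + algebraMap F K z.re.im * (sgn K q * t) +
        (algebraMap F K z.im.re + algebraMap F K z.im.im * (sgn K q * t)) * (sgn K p * s) :=
  rfl

theorem evalBiquad_injective [NeZero (2 : K)] (hs0 : s ≠ 0) (ht0 : t ≠ 0) {z w : Biquad u v}
    (h : ∀ p q, evalBiquad hs ht p q z = evalBiquad hs ht p q w) : z = w := by
  have h2 : (2 : K) ≠ 0 := NeZero.ne 2
  have h4 : (4 : K) ≠ 0 := by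
    rw [show (4 : K) = 2 * 2 by norm_num]; exact mul_ne_zero h2 h2
  have hinj := (algebraMap F K).injective
  have h00 := h 0 0
  have h01 := h 0 1
  have h10 := h 1 0
  have h11 := h 1 1
  simp only [evalBiquad_apply, sgn_zero, sgn_one, one_mul] at h00 h01 h10 h11
  ext <;> apply hinj
  · apply mul_left_cancel₀ h4
    linear_combination h00 + h01 + h10 + h11
  · apply mul_left_cancel₀ (mul_ne_zero h4 ht0)
    linear_combination h00 - h01 + h10 - h11
  · apply mul_left_cancel₀ (mul_ne_zero h4 hs0)
    linear_combination h00 + h01 - h10 - h11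
  · apply mul_left_cancel₀ (mul_ne_zero (mul_ne_zero h4 hs0) ht0)
    linear_combination h00 - h01 - h10 + h11

theorem evalBiquad_sigmaLeft (p q : ZMod 2) (z : Biquad u v) :
    evalBiquad hs ht p q (sigmaLeft u v z) = evalBiquad hs ht (p + 1) q z := by
  simp [evalBiquad_apply, sgn_add, sigmaLeft]
  ring

theorem evalBiquad_sigmaRight (p q : ZMod 2) (z : Biquad u v) :
    evalBiquad hs ht p q (sigmaRight u v z) = evalBiquad hs ht p (q + 1) z := by
  simp [evalBiquad_apply, sgn_add, sigmaRight, conj]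

theorem evalBiquad_inclRight (p q : ZMod 2) (z : Quad v) :
    evalBiquad hs ht p q (inclRight u v z) = evalSign ht q z := by
  have h : inclRight u v z = ⟨z, 0⟩ := rfl
  simp [h, evalBiquad, evalQuad_apply]

theorem evalBiquad_inclLeft (p q : ZMod 2) (z : Quad u) :
    evalBiquad hs ht p q (inclLeft u v z) = evalSign hs p z := by
  have h : inclLeft u v z = ⟨algebraMap F _ z.re, algebraMap F _ z.im⟩ := rfl
  simp [h, evalBiquad, evalSign, evalQuad_apply]

theorem evalSign_norm (q : ZMod 2) (z : Biquad u v) :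
    evalSign ht q (Algebra.norm (Quad v) z) =
      evalBiquad hs ht 0 q z * evalBiquad hs ht 1 q z :=
  evalQuad_norm _ _ _ (by simp) z

theorem algebraMap_norm_biquad (z : Biquad u v) :
    algebraMap F K (Algebra.norm F z) =
      (evalBiquad hs ht 0 0 z * evalBiquad hs ht 1 0 z) *
        (evalBiquad hs ht 0 1 z * evalBiquad hs ht 1 1 z) := by
  rw [norm_biquad, ← evalSign_norm hs ht 0, ← evalSign_norm hs ht 1]
  exact evalQuad_norm _ _ _ (by simp) _

theorem apply_evalBiquad (g : Gal(K/F)) {x y : ZMod 2} (hx : g s = sgn K x * s)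
    (hy : g t = sgn K y * t) (p q : ZMod 2) (z : Biquad u v) :
    g (evalBiquad hs ht (p + x) (q + y) z) = evalBiquad hs ht p q z := by
  simp only [evalBiquad_apply, map_add, map_mul, AlgEquiv.commutes, map_sgn, hx, hy, sgn_add]
  have h1 : sgn K q * sgn K y * (sgn K y * t) = sgn K q * t := by
    linear_combination sgn K q * t * sgn_mul_self (R := K) y
  have h2 : sgn K p * sgn K x * (sgn K x * s) = sgn K p * s := by
    linear_combination sgn K p * s * sgn_mul_self (R := K) x
  rw [h1, h2]

/-- The sum of the members of a family permuted by the Galois group lies in the base field. -/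
theorem exists_algebraMap_eq_sum [IsGalois F K] {χ ψ : Gal(K/F) → ZMod 2}
    (Ω : ZMod 2 → ZMod 2 → K) (hΩ : ∀ (g : Gal(K/F)) p q, g (Ω (p + χ g) (q + ψ g)) = Ω p q) :
    ∃ x : F, algebraMap F K x = ∑ p, ∑ q, Ω p q := by
  refine (InfiniteGalois.mem_range_algebraMap_iff_fixed _).2 fun g => ?_
  have h : ∑ p, ∑ q, Ω p q = ∑ p, ∑ q, Ω (p + χ g) (q + ψ g) := by
    rw [← Equiv.sum_comp (Equiv.addRight (χ g))]
    refine Finset.sum_congr rfl fun p _ => ?_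
    rw [← Equiv.sum_comp (Equiv.addRight (ψ g))]
    rfl
  conv_lhs => rw [h]
  simp only [map_sum, hΩ]

/-- Galois descent for `F_{u,v}`: its elements are the families `Ω` of elements of `K`, indexed by
the choices of signs of the two square roots, that the Galois group permutes in the same way as it
permutes the square roots. -/
theorem exists_evalBiquad_eq [IsGalois F K] [NeZero (2 : K)] (hs0 : s ≠ 0) (ht0 : t ≠ 0)
    {χ ψ : Gal(K/F) → ZMod 2} (hχ : ∀ g : Gal(K/F), g s = sgn K (χ g) * s)
    (hψ : ∀ g : Gal(K/F), g t = sgn K (ψ g) * t) (Ω : ZMod 2 → ZMod 2 → K)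
    (hΩ : ∀ (g : Gal(K/F)) p q, g (Ω (p + χ g) (q + ψ g)) = Ω p q) :
    ∃ z : Biquad u v, ∀ p q, evalBiquad hs ht p q z = Ω p q := by
  have h2 : (2 : K) ≠ 0 := NeZero.ne 2
  have h4 : (4 : K) ≠ 0 := by
    rw [show (4 : K) = 2 * 2 by norm_num]; exact mul_ne_zero h2 h2
  have hs' : ∀ (g : Gal(K/F)) p, g (sgn K (p + χ g) * s) = sgn K p * s := fun g p => by
    rw [map_mul, map_sgn, hχ, sgn_add]
    linear_combination sgn K p * s * sgn_mul_self (R := K) (χ g)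
  have ht' : ∀ (g : Gal(K/F)) p, g (sgn K (p + ψ g) * t) = sgn K p * t := fun g p => by
    rw [map_mul, map_sgn, hψ, sgn_add]
    linear_combination sgn K p * t * sgn_mul_self (R := K) (ψ g)
  -- The coefficients of `z` are given by inverting the Vandermonde matrix of the square roots.
  obtain ⟨x, hx⟩ := exists_algebraMap_eq_sum (χ := χ) (ψ := ψ) (fun p q => Ω p q / 4)
    fun g p q => by simp only [map_div₀, map_ofNat, hΩ]
  obtain ⟨y, hy⟩ := exists_algebraMap_eq_sum (χ := χ) (ψ := ψ)
    (fun p q => Ω p q / (4 * (sgn K q * t)))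
    fun g p q => by rw [map_div₀, map_mul, ht', map_ofNat, hΩ]
  obtain ⟨x', hx'⟩ := exists_algebraMap_eq_sum (χ := χ) (ψ := ψ)
    (fun p q => Ω p q / (4 * (sgn K p * s)))
    fun g p q => by rw [map_div₀, map_mul, hs', map_ofNat, hΩ]
  obtain ⟨y', hy'⟩ := exists_algebraMap_eq_sum (χ := χ) (ψ := ψ)
    (fun p q => Ω p q / (4 * (sgn K p * s) * (sgn K q * t)))
    fun g p q => by rw [map_div₀, map_mul, map_mul, hs', ht', map_ofNat, hΩ]
  have hsum : ∀ f : ZMod 2 → K, ∑ p, f p = f 0 + f 1 := fun f => Fin.sum_univ_two f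
  simp only [hsum, sgn_zero, sgn_one] at hx hy hx' hy'
  refine ⟨⟨⟨x, y⟩, ⟨x', y'⟩⟩, fun p q => ?_⟩
  rw [evalBiquad_apply]
  simp only [hx, hy, hx', hy']
  rcases eq_zero_or_one p with rfl | rfl <;> rcases eq_zero_or_one q with rfl | rfl <;>
  · simp only [sgn_zero, sgn_one]
    field_simp
    ring

/-- A nowhere vanishing family as in `exists_evalBiquad_eq` comes from a unit of `F_{u,v}`. -/
theorem exists_unit_evalBiquad_eq [IsGalois F K] [NeZero (2 : K)] (hs0 : s ≠ 0) (ht0 : t ≠ 0)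
    {χ ψ : Gal(K/F) → ZMod 2} (hχ : ∀ g : Gal(K/F), g s = sgn K (χ g) * s)
    (hψ : ∀ g : Gal(K/F), g t = sgn K (ψ g) * t) (Ω : ZMod 2 → ZMod 2 → K)
    (hΩ0 : ∀ p q, Ω p q ≠ 0)
    (hΩ : ∀ (g : Gal(K/F)) p q, g (Ω (p + χ g) (q + ψ g)) = Ω p q) :
    ∃ z : (Biquad u v)ˣ, ∀ p q, evalBiquad hs ht p q z = Ω p q := by
  obtain ⟨z, hz⟩ := exists_evalBiquad_eq hs ht hs0 ht0 hχ hψ Ω hΩ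
  obtain ⟨w, hw⟩ := exists_evalBiquad_eq hs ht hs0 ht0 hχ hψ (fun p q => (Ω p q)⁻¹)
    fun g p q => by rw [map_inv₀, hΩ]
  have h : z * w = 1 := evalBiquad_injective hs ht hs0 ht0 fun p q => by
    rw [map_mul, hz, hw, mul_inv_cancel₀ (hΩ0 p q), map_one]
  exact ⟨Units.mkOfMulEqOne z w h, hz⟩

end Evaluation

/-! ### Kummer theory and Hilbert's theorem 90 -/

section Kummer

variable {F K : Type*} [Field F] [Field K] [Algebra F K]

/-- Kummer theory of degree two over the fixed field of `N`: a continuous character `N → ℤ/2` is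
given by the action of `N` on a nonzero element `y` (a square root of an invariant element). -/
theorem exists_smul_eq_sgn_mul [IsGalois F K] [NeZero (2 : K)] (N : Subgroup Gal(K/F))
    (hN : IsClosed (N : Set Gal(K/F))) (κ : Gal(K/F) → ZMod 2) (hκ : Continuous κ)
    (hmul : ∀ g ∈ N, ∀ h ∈ N, κ (g * h) = κ g + κ h) :
    ∃ y : K, y ≠ 0 ∧ ∀ g ∈ N, g y = sgn K (κ g) * y := by
  by_cases htriv : ∀ g ∈ N, κ g = 0
  · exact ⟨1, one_ne_zero, fun g hg => by rw [htriv g hg, map_one, sgn_zero, one_mul]⟩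
  push Not at htriv
  obtain ⟨g₀, hg₀, hκ₀⟩ := htriv
  have h1 : κ 1 = 0 := by simpa using hmul 1 N.one_mem 1 N.one_mem
  have hinv : ∀ g ∈ N, κ g⁻¹ = κ g := fun g hg => by
    have h := hmul g hg g⁻¹ (N.inv_mem hg)
    rw [mul_inv_cancel, h1] at h
    rw [← add_right_inj (κ g), ← h, CharTwo.add_self_eq_zero]
  let N' : ClosedSubgroup Gal(K/F) :=
    { carrier := {g | g ∈ N ∧ κ g = 0}
      mul_mem' := fun {g h} hg hh => ⟨N.mul_mem hg.1 hh.1, by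
        rw [hmul g hg.1 h hh.1, hg.2, hh.2, add_zero]⟩
      one_mem' := ⟨N.one_mem, h1⟩
      inv_mem' := fun {g} hg => ⟨N.inv_mem hg.1, by rw [hinv g hg.1, hg.2]⟩
      isClosed' := hN.inter (isClosed_singleton.preimage hκ) }
  have hmem : ∀ g, g ∈ N' ↔ g ∈ N ∧ κ g = 0 := fun g => Iff.rfl
  -- By the Galois correspondence `g₀ ∉ N'` moves some element fixed by `N'`.
  obtain ⟨z, hz, hz₀⟩ : ∃ z, (∀ g ∈ N', g z = z) ∧ g₀ z ≠ z := by
    by_contra! hcon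
    have hfix : g₀ ∈ (IntermediateField.fixedField N'.toSubgroup).fixingSubgroup := by
      rw [IntermediateField.mem_fixingSubgroup_iff]
      exact fun z hz => hcon z fun g hg =>
        (IntermediateField.mem_fixedField_iff _ _).1 hz g hg
    rw [InfiniteGalois.fixingSubgroup_fixedField] at hfix
    exact hκ₀ hfix.2
  have hκ₀' : κ g₀ = 1 := (eq_zero_or_one _).resolve_left hκ₀
  have h11 : (1 : ZMod 2) + 1 = 0 := by decide
  have hconj : ∀ g ∈ N, κ g = 0 → g (g₀ z) = g₀ z := fun g hg hg0 => by
    have h : g₀⁻¹ * g * g₀ ∈ N' := ⟨N.mul_mem (N.mul_mem (N.inv_mem hg₀) hg) hg₀, by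
      rw [hmul _ (N.mul_mem (N.inv_mem hg₀) hg) _ hg₀, hmul _ (N.inv_mem hg₀) _ hg,
        hinv _ hg₀, hg0, hκ₀', add_zero, h11]⟩
    have h' := congrArg g₀ (hz _ h)
    rwa [← AlgEquiv.mul_apply, ← mul_assoc, ← mul_assoc, mul_inv_cancel, one_mul] at h'
  refine ⟨z - g₀ z, sub_ne_zero.2 hz₀.symm, fun g hg => ?_⟩
  rcases eq_zero_or_one (κ g) with hg0 | hg1
  · rw [map_sub, hz g ⟨hg, hg0⟩, hconj g hg hg0, hg0, sgn_zero, one_mul]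
  · have hmove : ∀ h ∈ N, κ h = 1 → h z = g₀ z := fun h hh h1 => by
      have h' := congrArg g₀ (hz (g₀⁻¹ * h) ⟨N.mul_mem (N.inv_mem hg₀) hh, by
        rw [hmul _ (N.inv_mem hg₀) _ hh, hinv _ hg₀, h1, hκ₀', h11]⟩)
      rwa [← AlgEquiv.mul_apply, ← mul_assoc, mul_inv_cancel, one_mul] at h'
    have hback : g (g₀ z) = z := hz (g * g₀) ⟨N.mul_mem hg hg₀, by
      rw [hmul _ hg _ hg₀, hg1, hκ₀', h11]⟩
    rw [map_sub, hmove g hg hg1, hback, hg1, sgn_one]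
    ring

/-- Hilbert's theorem 90 for the étale algebra attached to the action of the Galois group on an
abelian group `I` by translation through `τ`, for cocycles `φ` with values in signs:
`φ` becomes trivial after multiplication by a nowhere vanishing family `r`. -/
theorem exists_family_of_cocycle [IsGalois F K] [NeZero (2 : K)] {I : Type*} [AddCommGroup I]
    [TopologicalSpace I] [T1Space I] (τ : Gal(K/F) → I) (hτ : Continuous τ)
    (hτmul : ∀ g h, τ (g * h) = τ g + τ h) (φ : Gal(K/F) → I → ZMod 2)
    (hφ : ∀ i, Continuous fun g => φ g i)
    (hφmul : ∀ g h i, φ (g * h) i = φ g i + φ h (i + τ g)) :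
    ∃ r : I → K, (∀ i, r i ≠ 0) ∧
      ∀ (g : Gal(K/F)) i, g (r (i + τ g)) = sgn K (φ g i) * r i := by
  let τ' : Gal(K/F) →* Multiplicative I :=
    MonoidHom.mk' (fun g => Multiplicative.ofAdd (τ g)) fun g h => by rw [hτmul]; rfl
  let N := τ'.ker
  have hmemN : ∀ g, g ∈ N ↔ τ g = 0 := fun g => Iff.rfl
  have hNclosed : IsClosed (N : Set Gal(K/F)) := (isClosed_singleton (x := (0 : I))).preimage hτ
  have hy : ∀ i, ∃ y : K, y ≠ 0 ∧ ∀ g ∈ N, g y = sgn K (φ g i) * y := fun i =>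
    exists_smul_eq_sgn_mul N hNclosed (fun g => φ g i) (hφ i) fun g hg h _ => by
      rw [hφmul, (hmemN g).1 hg, add_zero]
  choose y hy0 hy using hy
  -- Choose a base point `o i` in each orbit, and `k i` carrying it to `i`.
  let A : AddSubgroup I := Subgroup.toAddSubgroup' τ'.range
  have hA : ∀ x, x ∈ A ↔ ∃ g, τ g = x := fun x => Iff.rfl
  let o : I → I := fun i => Quotient.out (QuotientAddGroup.mk i : I ⧸ A)
  have ho : ∀ (g : Gal(K/F)) i, o (i + τ g) = o i := fun g i => by
    have : (QuotientAddGroup.mk (i + τ g) : I ⧸ A) = QuotientAddGroup.mk i := by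
      rw [eq_comm, QuotientAddGroup.eq]
      exact (hA _).2 ⟨g, by abel⟩
    simp only [o, this]
  have hk : ∀ i, ∃ g, o i + τ g = i := fun i => by
    have : (QuotientAddGroup.mk (o i) : I ⧸ A) = QuotientAddGroup.mk i := Quotient.out_eq _
    rw [QuotientAddGroup.eq] at this
    obtain ⟨g, hg⟩ := (hA _).1 this
    exact ⟨g, by rw [hg]; abel⟩
  choose k hk using hk
  refine ⟨fun i => sgn K (φ (k i) (o i)) * (k i)⁻¹ (y (o i)), fun i =>
    mul_ne_zero (sgn_ne_zero _) ((map_ne_zero _).2 (hy0 _)), fun g i => ?_⟩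
  set k' := k (i + τ g)
  have hk' : o i + τ k' = i + τ g := by rw [← ho g i]; exact hk _
  have h1 : τ 1 = 0 := by simpa using hτmul 1 1
  set h := k i * g * k'⁻¹
  have hh : h ∈ N := by
    have e : τ k' + τ k'⁻¹ = 0 := by rw [← hτmul, mul_inv_cancel, h1]
    have e' := hk i
    rw [hmemN, hτmul, hτmul]
    apply add_left_cancel (a := o i)
    calc o i + (τ (k i) + τ g + τ k'⁻¹) = (o i + τ (k i) + τ g) + τ k'⁻¹ := by abel
      _ = (o i + τ k') + τ k'⁻¹ := by rw [e', hk']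
      _ = o i + 0 := by rw [add_assoc, e]
  have hkey : φ h (o i) + φ k' (o i) = φ (k i) (o i) + φ g i := by
    have e1 := hφmul h k' (o i)
    have e2 := hφmul (k i) g (o i)
    rw [(hmemN h).1 hh, add_zero] at e1
    rw [hk i] at e2
    rw [← e1, ← e2, inv_mul_cancel_right]
  have hact : g (k'⁻¹ (y (o i))) = (k i)⁻¹ (h (y (o i))) := by
    rw [← AlgEquiv.mul_apply, ← AlgEquiv.mul_apply]
    congr 1
    simp only [h]; group
  simp only [ho, map_mul, map_sgn]
  rw [hact, hy _ h hh, map_mul, map_sgn, ← mul_assoc, ← mul_assoc, ← sgn_add, ← sgn_add,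
    add_comm, hkey, add_comm]

end Kummer

/-! ### Fourfold Massey products and unipotent representations -/

section Lifts

variable {Γ : Type*} [Group Γ] [TopologicalSpace Γ]

/-- The functions `u, v, w` complete the characters `χ₁, χ₂, χ₃` to a continuous homomorphism
from `Γ` to the unipotent upper triangular matrices of size `4` over `ℤ/2`: the first
superdiagonal is `(χ₁, χ₂, χ₃)`, the second is `(u, v)`, and `w` is the corner entry. -/
structure IsUnipotentLift (χ₁ χ₂ χ₃ u v w : Γ → ZMod 2) : Prop where
  continuous₁ : Continuous u
  continuous₂ : Continuous v
  continuous₃ : Continuous w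
  mul₁ : ∀ g h, u (g * h) = u g + u h + χ₁ g * χ₂ h
  mul₂ : ∀ g h, v (g * h) = v g + v h + χ₂ g * χ₃ h
  mul₃ : ∀ g h, w (g * h) = w g + w h + χ₁ g * v h + u g * χ₃ h

/-- The 1-cochain given by a continuous function. -/
def cochainOfFun (f : Γ → ZMod 2) (hf : Continuous f) : Cochain Γ 1 where
  toFun g := f (g 0)
  continuous_toFun := hf.comp (by fun_prop)

theorem continuous_cochain_apply {Γ : Type*} [TopologicalSpace Γ] (f : Cochain Γ 1) :
    Continuous fun g => f ![g] :=
  f.continuous.comp (continuous_pi fun i => by fin_cases i; exact continuous_id)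

variable [ContinuousMul Γ]

theorem d_one_eq_iff (f : Cochain Γ 1) (c : Cochain Γ 2) :
    d 1 f = c ↔ ∀ g h, f ![g * h] = f ![g] + f ![h] + c ![g, h] := by
  have key : ∀ x y z t : ZMod 2, x + y + z = t ↔ y = z + x + t := by decide
  constructor
  · intro e g h
    rw [← key, ← e, d_one_apply]
    rfl
  · intro e
    ext G
    have hG : G = ![G 0, G 1] := by funext i; fin_cases i <;> rfl
    rw [d_one_apply, key, e (G 0) (G 1), ← hG]

/-- With trivial coefficients the only 1-coboundary is zero. -/
theorem cls_one_injective : Function.Injective (cls : cocycles Γ 1 → H Γ 1) := by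
  intro f f' h
  obtain ⟨k, hk⟩ := QuotientAddGroup.eq.1 h
  have h0 : d 0 k = 0 := by
    ext g
    change k _ + ∑ j : Fin 1, k _ = 0
    rw [Fin.sum_univ_one, Subsingleton.elim (Fin.contractNth (0 : Fin 1) (· * ·) g)
      (fun i => g i.succ), CharTwo.add_self_eq_zero]
  rw [h0] at hk
  have hk' : -f + f' = 0 := Subtype.ext hk.symm
  exact (neg_add_eq_zero.1 hk')

/-- A defining system for `⟨χ₀, χ₁, χ₂, χ₃⟩` is a pair of unipotent lifts of `(χ₀, χ₁, χ₂)` and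
`(χ₁, χ₂, χ₃)` that agree on their common entry `v`. -/
theorem masseyProduct_four_nonempty_iff (χ : Fin 4 → cocycles Γ 1) :
    (masseyProduct fun i => cls (χ i)).Nonempty ↔
      ∃ u v v' w w' : Γ → ZMod 2,
        IsUnipotentLift (fun g => (χ 0 : Cochain Γ 1) ![g]) (fun g => (χ 1 : Cochain Γ 1) ![g])
          (fun g => (χ 2 : Cochain Γ 1) ![g]) u v w ∧
        IsUnipotentLift (fun g => (χ 1 : Cochain Γ 1) ![g]) (fun g => (χ 2 : Cochain Γ 1) ![g])
          (fun g => (χ 3 : Cochain Γ 1) ![g]) v v' w' := by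
  have I02 : Finset.Ioo (0 : Fin 5) 2 = {1} := by decide
  have I13 : Finset.Ioo (1 : Fin 5) 3 = {2} := by decide
  have I24 : Finset.Ioo (2 : Fin 5) 4 = {3} := by decide
  have I03 : Finset.Ioo (0 : Fin 5) 3 = {1, 2} := by decide
  have I14 : Finset.Ioo (1 : Fin 5) 4 = {2, 3} := by decide
  constructor
  · rintro ⟨_, M, hM, -⟩
    have hχ : ∀ i : Fin 4, M i.castSucc i.succ = χ i := fun i => by
      obtain ⟨h, e⟩ := hM.represents i
      exact congrArg Subtype.val (cls_one_injective e)
    have h01 : M 0 1 = χ 0 := hχ 0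
    have h12 : M 1 2 = χ 1 := hχ 1
    have h23 : M 2 3 = χ 2 := hχ 2
    have h34 : M 3 4 = χ 3 := hχ 3
    have d02 := hM.differential 0 2 (by decide) (by decide)
    have d13 := hM.differential 1 3 (by decide) (by decide)
    have d24 := hM.differential 2 4 (by decide) (by decide)
    have d03 := hM.differential 0 3 (by decide) (by decide)
    have d14 := hM.differential 1 4 (by decide) (by decide)
    rw [I02, Finset.sum_singleton, h01, h12, d_one_eq_iff] at d02
    rw [I13, Finset.sum_singleton, h12, h23, d_one_eq_iff] at d13
    rw [I24, Finset.sum_singleton, h23, h34, d_one_eq_iff] at d24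
    rw [I03, Finset.sum_pair (by decide), h01, h23, d_one_eq_iff] at d03
    rw [I14, Finset.sum_pair (by decide), h12, h34, d_one_eq_iff] at d14
    simp only [ContinuousMap.add_apply, cup_one_one_apply, Matrix.cons_val_zero,
      Matrix.cons_val_one, ← add_assoc] at d02 d13 d24 d03 d14
    exact ⟨fun g => M 0 2 ![g], fun g => M 1 3 ![g], fun g => M 2 4 ![g], fun g => M 0 3 ![g],
      fun g => M 1 4 ![g],
      ⟨continuous_cochain_apply _, continuous_cochain_apply _, continuous_cochain_apply _,
        d02, d13, d03⟩,
      ⟨continuous_cochain_apply _, continuous_cochain_apply _, continuous_cochain_apply _,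
        d13, d24, d14⟩⟩
  · rintro ⟨u, v, v', w, w', h, h'⟩
    let M : Fin 5 → Fin 5 → Cochain Γ 1 :=
      ![![0, χ 0, cochainOfFun u h.continuous₁, cochainOfFun w h.continuous₃, 0],
        ![0, 0, χ 1, cochainOfFun v h.continuous₂, cochainOfFun w' h'.continuous₃],
        ![0, 0, 0, χ 2, cochainOfFun v' h'.continuous₂],
        ![0, 0, 0, 0, χ 3], 0]
    have hM : IsDefiningSystem (fun i => cls (χ i)) M := by
      constructor
      · intro i
        have e : M i.castSucc i.succ = χ i := by fin_cases i <;> rfl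
        exact ⟨e ▸ (χ i).2, congrArg cls (Subtype.ext e)⟩
      · have d02 : d 1 (M 0 2) = ∑ l ∈ Finset.Ioo 0 2, cup (M 0 l) (M l 2) := by
          rw [I02, Finset.sum_singleton, d_one_eq_iff]
          intro g k
          rw [cup_one_one_apply]
          exact h.mul₁ g k
        have d13 : d 1 (M 1 3) = ∑ l ∈ Finset.Ioo 1 3, cup (M 1 l) (M l 3) := by
          rw [I13, Finset.sum_singleton, d_one_eq_iff]
          intro g k
          rw [cup_one_one_apply]
          exact h.mul₂ g k
        have d24 : d 1 (M 2 4) = ∑ l ∈ Finset.Ioo 2 4, cup (M 2 l) (M l 4) := by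
          rw [I24, Finset.sum_singleton, d_one_eq_iff]
          intro g k
          rw [cup_one_one_apply]
          exact h'.mul₂ g k
        have d03 : d 1 (M 0 3) = ∑ l ∈ Finset.Ioo 0 3, cup (M 0 l) (M l 3) := by
          rw [I03, Finset.sum_pair (by decide), d_one_eq_iff]
          intro g k
          rw [ContinuousMap.add_apply, cup_one_one_apply, cup_one_one_apply, ← add_assoc]
          exact h.mul₃ g k
        have d14 : d 1 (M 1 4) = ∑ l ∈ Finset.Ioo 1 4, cup (M 1 l) (M l 4) := by
          rw [I14, Finset.sum_pair (by decide), d_one_eq_iff]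
          intro g k
          rw [ContinuousMap.add_apply, cup_one_one_apply, cup_one_one_apply, ← add_assoc]
          exact h'.mul₃ g k
        intro i j hij hne
        have hcases : (i = 0 ∧ j = 2) ∨ (i = 1 ∧ j = 3) ∨ (i = 2 ∧ j = 4) ∨ (i = 0 ∧ j = 3) ∨
            (i = 1 ∧ j = 4) := by
          revert i j; decide
        rcases hcases with ⟨rfl, rfl⟩ | ⟨rfl, rfl⟩ | ⟨rfl, rfl⟩ | ⟨rfl, rfl⟩ | ⟨rfl, rfl⟩
        exacts [d02, d13, d24, d03, d14]
    exact ⟨_, M, hM, rfl⟩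

end Lifts

/-! ### Unipotent lifts as families of square roots -/

section Families

variable {F K : Type*} [Field F] [Field K] [Algebra F K]

/-- The value at `(p, q)` of the cocycle in `Map((ℤ/2)², ℤ/2)` attached to the entries of a
unipotent matrix: it is `(1 p) B (q 1)ᵗ`, where `B` is the product of the upper right and the lower
right `2 × 2` blocks of the matrix with first superdiagonal `(_, y, z)`, second superdiagonal
`(u, v)` and corner `w`. -/
def blockValue (y z u v w p q : ZMod 2) : ZMod 2 :=
  w + (q + z) * u + p * v + p * (q + z) * y

/-- The family `r` is permuted by `g` according to the translation by `(χ₁ g, χ₃ g)`, up to the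
signs given by the cocycle of the matrices with entries `χ₁, χ₂, χ₃, u, v, w`. -/
def IsRootFamily (χ₁ χ₂ χ₃ u v w : Gal(K/F) → ZMod 2) (r : ZMod 2 → ZMod 2 → K) : Prop :=
  ∀ (g : Gal(K/F)) p q, g (r (p + χ₁ g) (q + χ₃ g)) =
    sgn K (blockValue (χ₂ g) (χ₃ g) (u g) (v g) (w g) p q) * r p q

/-- The upper right blocks of a unipotent lift form a cocycle in the module induced from the kernel
of `(χ₁, χ₃)`, to which Hilbert's theorem 90 applies. -/
theorem IsUnipotentLift.exists_isRootFamily [IsGalois F K] [NeZero (2 : K)]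
    {χ₁ χ₂ χ₃ u v w : Gal(K/F) → ZMod 2} (hc₁ : Continuous χ₁) (hc₂ : Continuous χ₂)
    (hc₃ : Continuous χ₃) (h₁ : ∀ g h, χ₁ (g * h) = χ₁ g + χ₁ h)
    (h₂ : ∀ g h, χ₂ (g * h) = χ₂ g + χ₂ h) (h₃ : ∀ g h, χ₃ (g * h) = χ₃ g + χ₃ h)
    (H : IsUnipotentLift χ₁ χ₂ χ₃ u v w) :
    ∃ r : ZMod 2 → ZMod 2 → K, (∀ p q, r p q ≠ 0) ∧ IsRootFamily χ₁ χ₂ χ₃ u v w r := by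
  have hu := H.continuous₁
  have hv := H.continuous₂
  have hw := H.continuous₃
  obtain ⟨r, hr0, hr⟩ := exists_family_of_cocycle (K := K) (F := F) (I := ZMod 2 × ZMod 2)
    (fun g => (χ₁ g, χ₃ g)) (hc₁.prodMk hc₃) (fun g h => by rw [h₁, h₃]; rfl)
    (fun g i => blockValue (χ₂ g) (χ₃ g) (u g) (v g) (w g) i.1 i.2)
    (fun i => by unfold blockValue; fun_prop)
    (fun g h i => by
      have two : (2 : ZMod 2) = 0 := by decide
      simp only [blockValue, h₂, h₃, H.mul₁, H.mul₂, H.mul₃, Prod.fst_add, Prod.snd_add]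
      ring_nf
      reduce_mod_char)
  exact ⟨fun p q => r (p, q), fun p q => hr0 _, fun g p q => hr g (p, q)⟩

namespace IsRootFamily

variable {χ₁ χ₂ χ₃ u v w : Gal(K/F) → ZMod 2} {r : ZMod 2 → ZMod 2 → K}

theorem apply_mul_left (hr : IsRootFamily χ₁ χ₂ χ₃ u v w r) (g : Gal(K/F)) (q : ZMod 2) :
    g (r 0 (q + χ₃ g) * r 1 (q + χ₃ g)) =
      sgn K (v g + (q + χ₃ g) * χ₂ g) * (r 0 q * r 1 q) := by
  have h11 : (1 : ZMod 2) + 1 = 0 := by decide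
  have hperm : r 0 (q + χ₃ g) * r 1 (q + χ₃ g) =
      r (0 + χ₁ g) (q + χ₃ g) * r (1 + χ₁ g) (q + χ₃ g) := by
    rcases eq_zero_or_one (χ₁ g) with e | e
    · rw [e, add_zero, add_zero]
    · rw [e, zero_add, h11, mul_comm]
  have hsgn : blockValue (χ₂ g) (χ₃ g) (u g) (v g) (w g) 0 q +
      blockValue (χ₂ g) (χ₃ g) (u g) (v g) (w g) 1 q = v g + (q + χ₃ g) * χ₂ g := by
    simp only [blockValue]
    ring_nf
    reduce_mod_char
  rw [hperm, map_mul, hr, hr, ← hsgn, sgn_add]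
  ring

theorem apply_mul_right (hr : IsRootFamily χ₁ χ₂ χ₃ u v w r) (g : Gal(K/F)) (p : ZMod 2) :
    g (r (p + χ₁ g) 0 * r (p + χ₁ g) 1) =
      sgn K (u g + p * χ₂ g) * (r p 0 * r p 1) := by
  have h11 : (1 : ZMod 2) + 1 = 0 := by decide
  have hperm : r (p + χ₁ g) 0 * r (p + χ₁ g) 1 =
      r (p + χ₁ g) (0 + χ₃ g) * r (p + χ₁ g) (1 + χ₃ g) := by
    rcases eq_zero_or_one (χ₃ g) with e | e
    · rw [e, add_zero, add_zero]
    · rw [e, zero_add, h11, mul_comm]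
  have hsgn : blockValue (χ₂ g) (χ₃ g) (u g) (v g) (w g) p 0 +
      blockValue (χ₂ g) (χ₃ g) (u g) (v g) (w g) p 1 = u g + p * χ₂ g := by
    simp only [blockValue]
    ring_nf
    reduce_mod_char
  rw [hperm, map_mul, hr, hr, ← hsgn, sgn_add]
  ring

theorem apply_prod (hr : IsRootFamily χ₁ χ₂ χ₃ u v w r) (g : Gal(K/F)) :
    g (r 0 0 * r 0 1 * r 1 0 * r 1 1) =
      sgn K (χ₂ g) * (r 0 0 * r 0 1 * r 1 0 * r 1 1) := by
  have h11 : (1 : ZMod 2) + 1 = 0 := by decide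
  have hperm : r 0 0 * r 0 1 * r 1 0 * r 1 1 =
      (r (0 + χ₁ g) 0 * r (0 + χ₁ g) 1) * (r (1 + χ₁ g) 0 * r (1 + χ₁ g) 1) := by
    rcases eq_zero_or_one (χ₁ g) with e | e
    · rw [e, add_zero, add_zero]; ring
    · rw [e, zero_add, h11]; ring
  have hsgn : (u g + 0 * χ₂ g) + (u g + 1 * χ₂ g) = χ₂ g := by
    ring_nf
    reduce_mod_char
  conv_lhs => rw [hperm]
  rw [map_mul, hr.apply_mul_right, hr.apply_mul_right]
  conv_rhs => rw [← hsgn, sgn_add]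
  ring

theorem apply_sq (hr : IsRootFamily χ₁ χ₂ χ₃ u v w r) (g : Gal(K/F)) (p q : ZMod 2) :
    g (r (p + χ₁ g) (q + χ₃ g) ^ 2) = r p q ^ 2 := by
  rw [map_pow, hr, mul_pow, sgn_sq, one_mul]

end IsRootFamily

theorem eventually_apply_eq [Algebra.IsIntegral F K] (g : Gal(K/F)) (x : K) :
    ∀ᶠ h : Gal(K/F) in nhds g, h x = g x := by
  have hopen := stabilizer_isOpen_of_isIntegral (K := F) x
  have : ∀ᶠ h : Gal(K/F) in nhds g, g⁻¹ * h ∈ MulAction.stabilizer Gal(K/F) x :=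
    (hopen.preimage (continuous_const_mul g⁻¹)).mem_nhds (by simp)
  filter_upwards [this] with h hh
  have hh' : (g⁻¹ * h) x = x := hh
  rw [← mul_inv_cancel_left g h, AlgEquiv.mul_apply, hh']

/-- Conversely, a family whose squares are permuted by the Galois group has a sign cocycle. A
function on `(ℤ/2)²` is a polynomial `w' + q u' + p v' + p q y'`, so the cocycle consists of the
entries of a lift of `(χ₁, χ₂, χ₃)` once `y' = χ₂`; as `y'` is the sum of the values of the
function, this is the hypothesis on the product of the family. -/
theorem exists_isUnipotentLift_of_sq [IsGalois F K] [NeZero (2 : K)]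
    {χ₁ χ₂ χ₃ : Gal(K/F) → ZMod 2} (hc₁ : Continuous χ₁) (hc₂ : Continuous χ₂)
    (hc₃ : Continuous χ₃) (h₁ : ∀ g h, χ₁ (g * h) = χ₁ g + χ₁ h)
    (h₂ : ∀ g h, χ₂ (g * h) = χ₂ g + χ₂ h) (h₃ : ∀ g h, χ₃ (g * h) = χ₃ g + χ₃ h)
    {r : ZMod 2 → ZMod 2 → K} (hr0 : ∀ p q, r p q ≠ 0)
    (hr : ∀ (g : Gal(K/F)) p q, g (r (p + χ₁ g) (q + χ₃ g) ^ 2) = r p q ^ 2)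
    (hprod : ∀ g : Gal(K/F), g (r 0 0 * r 0 1 * r 1 0 * r 1 1) =
      sgn K (χ₂ g) * (r 0 0 * r 0 1 * r 1 0 * r 1 1)) :
    ∃ u v w, IsUnipotentLift χ₁ χ₂ χ₃ u v w ∧ IsRootFamily χ₁ χ₂ χ₃ u v w r := by
  have h11 : (1 : ZMod 2) + 1 = 0 := by decide
  have hφ : ∀ (g : Gal(K/F)) p q, ∃ t, g (r (p + χ₁ g) (q + χ₃ g)) = sgn K t * r p q :=
    fun g p q => exists_eq_sgn_mul_of_sq_eq (by rw [← map_pow, hr])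
  choose φ hφ using hφ
  have hcont : ∀ p q, Continuous fun g => φ g p q := fun p q => by
    refine IsLocallyConstant.continuous ((IsLocallyConstant.iff_eventually_eq _).2 fun g => ?_)
    filter_upwards [eventually_apply_eq g (r (p + χ₁ g) (q + χ₃ g)),
      (IsLocallyConstant.iff_eventually_eq _).1 ((IsLocallyConstant.iff_continuous _).2 hc₁) g,
      (IsLocallyConstant.iff_eventually_eq _).1 ((IsLocallyConstant.iff_continuous _).2 hc₃) g]
      with h e e₁ e₃
    apply sgn_injective (K := K)
    apply mul_right_cancel₀ (hr0 p q)
    rw [← hφ, ← hφ, e₁, e₃, e]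
  have hmul : ∀ g h p q, φ (g * h) p q = φ g p q + φ h (p + χ₁ g) (q + χ₃ g) := fun g h p q => by
    apply sgn_injective (K := K)
    apply mul_right_cancel₀ (hr0 p q)
    rw [← hφ, h₁, h₃, AlgEquiv.mul_apply, ← add_assoc, ← add_assoc, hφ h, map_mul, map_sgn, hφ g,
      sgn_add]
    ring
  have hsum : ∀ g, φ g 0 0 + φ g 0 1 + φ g 1 0 + φ g 1 1 = χ₂ g := fun g => by
    apply sgn_injective (K := K)
    have hne : r 0 0 * r 0 1 * r 1 0 * r 1 1 ≠ 0 := by simp [hr0]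
    apply mul_right_cancel₀ hne
    have hperm : g (r 0 0 * r 0 1 * r 1 0 * r 1 1) =
        g (r (0 + χ₁ g) (0 + χ₃ g)) * g (r (0 + χ₁ g) (1 + χ₃ g)) *
          g (r (1 + χ₁ g) (0 + χ₃ g)) * g (r (1 + χ₁ g) (1 + χ₃ g)) := by
      rcases eq_zero_or_one (χ₁ g) with e | e <;> rcases eq_zero_or_one (χ₃ g) with e' | e' <;>
      · simp only [e, e', add_zero, zero_add, h11, map_mul]
        try ring
    rw [← hprod, hperm, hφ, hφ, hφ, hφ]
    simp only [sgn_add]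
    ring
  -- Solve `φ g p q = blockValue (χ₂ g) (χ₃ g) (u g) (v g) (w g) p q` for `u`, `v` and `w`.
  let u : Gal(K/F) → ZMod 2 := fun g => φ g 0 1 + φ g 0 0
  let v : Gal(K/F) → ZMod 2 := fun g => φ g 1 0 + φ g 0 0 + χ₃ g * χ₂ g
  let w : Gal(K/F) → ZMod 2 := fun g => φ g 0 0 + χ₃ g * u g
  have hblock : ∀ g p q, φ g p q = blockValue (χ₂ g) (χ₃ g) (u g) (v g) (w g) p q := by
    intro g p q
    have hs := hsum g
    simp only [u, v, w, blockValue]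
    rcases eq_zero_or_one p with rfl | rfl <;> rcases eq_zero_or_one q with rfl | rfl
    · linear_combination (norm := (ring_nf; try reduce_mod_char))
    · linear_combination (norm := (ring_nf; try reduce_mod_char))
    · linear_combination (norm := (ring_nf; try reduce_mod_char))
    · linear_combination (norm := (ring_nf; try reduce_mod_char)) hs
  have hmul' := hmul
  simp only [hblock, blockValue] at hmul'
  have hmulu : ∀ g h, u (g * h) = u g + u h + χ₁ g * χ₂ h := fun g h => by
    linear_combination (norm := (ring_nf; try reduce_mod_char))
      hmul' g h 0 1 + hmul' g h 0 0
  refine ⟨u, v, w, ⟨?_, ?_, ?_, hmulu, fun g h => ?_, fun g h => ?_⟩, fun g p q => ?_⟩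
  · exact (hcont 0 1).add (hcont 0 0)
  · exact ((hcont 1 0).add (hcont 0 0)).add (hc₃.mul hc₂)
  · exact (hcont 0 0).add (hc₃.mul ((hcont 0 1).add (hcont 0 0)))
  · linear_combination (norm := (ring_nf; try reduce_mod_char))
      hmul' g h 1 0 + hmul' g h 0 0 + (χ₃ g + χ₃ h) * h₂ g h + χ₂ (g * h) * h₃ g h
  · linear_combination (norm := (ring_nf; try reduce_mod_char))
      hmul' g h 0 0 + χ₃ (g * h) * hmulu g h + (u g + u h + χ₁ g * χ₂ h) * h₃ g h
  · rw [hφ, hblock]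

end Families

/-! ### The operator `(σ - 1)(τ - 1)` and square classes -/

section SubOne

variable {F A : Type*} [Field F] [CommRing A] [Algebra F A]

theorem subOne_mul (σ : A ≃ₐ[F] A) (x : Aˣ) : (subOne σ x : A) * x = σ x := by
  rw [subOne, ← Units.val_mul, div_mul_cancel]; rfl

theorem subOne_eq_neg_one_iff (σ : A ≃ₐ[F] A) (x : Aˣ) : subOne σ x = -1 ↔ σ x = -(x : A) := by
  rw [← subOne_mul, Units.ext_iff, ← Units.mul_left_inj x]
  simp

theorem subOne_subOne_eq_neg_one_iff (σ τ : A ≃ₐ[F] A) (x : Aˣ) :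
    subOne σ (subOne τ x) = -1 ↔ σ (τ x) * x = -(σ x * τ x) := by
  have hu : IsUnit (σ x * (x : A)) := (x.isUnit.map σ).mul x.isUnit
  rw [subOne_eq_neg_one_iff, ← subOne_mul τ, map_mul, ← hu.mul_left_inj]
  constructor <;> intro h <;> linear_combination h

end SubOne

section Criterion

variable {F : Type*} [Field F] [NeZero (2 : F)]

theorem neZero_two_separableClosure : NeZero (2 : SeparableClosure F) := by
  refine ⟨fun h => NeZero.ne (2 : F) ((algebraMap F (SeparableClosure F)).injective ?_)⟩
  rw [map_ofNat, h, map_zero]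

theorem apply_sqrt (a : Fˣ) {s : SeparableClosure F} (hs : s ^ 2 = algebraMap F _ (a : F))
    (g : AbsGal F) : g s = sgn _ (kummerFun a g) * s := by
  rcases kummerFun_spec a g hs with ⟨e, h⟩ | ⟨e, h, -⟩ <;> simp [e, h]

/-- Injectivity of the Kummer map: `x` and `y` have the same square class if and only if `x` has a
square root on which the Galois group acts through the character of `y`. -/
theorem sqClass_eq_iff (x y : Fˣ) : sqClass x = sqClass y ↔
    ∃ m : SeparableClosure F, m ^ 2 = algebraMap F _ (x : F) ∧
      ∀ g : AbsGal F, g m = sgn _ (kummerFun y g) * m := by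
  obtain ⟨s, hs, hs0⟩ := exists_sqrt y
  rw [sqClass, sqClass, QuotientGroup.eq]
  constructor
  · rintro ⟨f, hf⟩
    have hy : y = x * f ^ 2 := by rw [eq_comm, ← eq_inv_mul_iff_mul_eq]; exact hf
    have hf0 : algebraMap F (SeparableClosure F) f ≠ 0 := by simp
    refine ⟨s / algebraMap F _ (f : F), ?_, fun g => ?_⟩
    · rw [div_pow, hs, hy, div_eq_iff (pow_ne_zero _ hf0)]
      simp
    · rw [map_div₀, apply_sqrt y hs, AlgEquiv.commutes, mul_div_assoc]
  · rintro ⟨m, hm, hg⟩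
    have hm0 : m ≠ 0 := by
      rintro rfl
      rw [zero_pow two_ne_zero, eq_comm, map_eq_zero] at hm
      exact x.ne_zero hm
    obtain ⟨f, hf⟩ := (InfiniteGalois.mem_range_algebraMap_iff_fixed (k := F) (s / m)).2
      fun g => by
        rw [map_div₀, hg, apply_sqrt y hs, mul_div_mul_left _ _ (sgn_ne_zero _)]
    have hf0 : f ≠ 0 := by
      rintro rfl
      rw [map_zero, eq_comm] at hf
      exact div_ne_zero hs0 hm0 hf
    refine ⟨Units.mk0 f hf0, ?_⟩
    rw [eq_inv_mul_iff_mul_eq]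
    ext
    apply (algebraMap F (SeparableClosure F)).injective
    simp only [powMonoidHom_apply, Units.val_mul, Units.val_pow_eq_pow_val, Units.val_mk0, map_mul,
      map_pow]
    rw [← hm, hf, ← hs]
    field_simp

theorem masseyProduct₄_nonempty_iff (a b c d : Fˣ) :
    (masseyProduct₄ a b c d).Nonempty ↔
      ∃ u v v' w w' : AbsGal F → ZMod 2,
        IsUnipotentLift (kummerFun a) (kummerFun b) (kummerFun c) u v w ∧
        IsUnipotentLift (kummerFun b) (kummerFun c) (kummerFun d) v v' w' := by
  have h := masseyProduct_four_nonempty_iff (Γ := AbsGal F)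
    ![⟨kummerCochain a, kummerCochain_mem a⟩, ⟨kummerCochain b, kummerCochain_mem b⟩,
      ⟨kummerCochain c, kummerCochain_mem c⟩, ⟨kummerCochain d, kummerCochain_mem d⟩]
  have e : (fun i => cls ((![⟨kummerCochain a, kummerCochain_mem a⟩,
      ⟨kummerCochain b, kummerCochain_mem b⟩, ⟨kummerCochain c, kummerCochain_mem c⟩,
      ⟨kummerCochain d, kummerCochain_mem d⟩] : Fin 4 → cocycles (AbsGal F) 1) i)) =
      ![kummerClass a, kummerClass b, kummerClass c, kummerClass d] := by
    funext i; fin_cases i <;> rfl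
  rw [e] at h
  exact h

end Criterion

/-! ### The criterion -/

section Conjugation

variable {Γ : Type*} [Group Γ] [TopologicalSpace Γ]

/-- Conjugation of a lift by a unipotent matrix: the entry `u` can be changed by a combination of
the neighbouring characters. -/
theorem IsUnipotentLift.add_characters {χ₁ χ₂ χ₃ u v w : Γ → ZMod 2} (hc₁ : Continuous χ₁)
    (hc₂ : Continuous χ₂) (hc₃ : Continuous χ₃) (h₁ : ∀ g h, χ₁ (g * h) = χ₁ g + χ₁ h)
    (h₂ : ∀ g h, χ₂ (g * h) = χ₂ g + χ₂ h) (h₃ : ∀ g h, χ₃ (g * h) = χ₃ g + χ₃ h)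
    (H : IsUnipotentLift χ₁ χ₂ χ₃ u v w) (x y : ZMod 2) :
    IsUnipotentLift χ₁ χ₂ χ₃ (fun g => u g + x * χ₁ g + y * χ₂ g) (fun g => v g + x * χ₃ g)
      (fun g => w g + y * v g) where
  continuous₁ := by have := H.continuous₁; fun_prop
  continuous₂ := by have := H.continuous₂; fun_prop
  continuous₃ := by have := H.continuous₂; have := H.continuous₃; fun_prop
  mul₁ g h := by linear_combination H.mul₁ g h + x * h₁ g h + y * h₂ g h
  mul₂ g h := by linear_combination H.mul₂ g h + x * h₃ g h
  mul₃ g h := by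
    linear_combination (norm := (ring_nf; try reduce_mod_char)) H.mul₃ g h + y * H.mul₂ g h

end Conjugation

section Main

variable {F : Type*} [Field F] [NeZero (2 : F)]

/-- Take `ε = r²`, `ν = r'²` and `ω = (-1)^{pq} R(q) S(p)` for the families `r`, `r'` of the two
lifts, where `R(q) = r(0,q) r(1,q)` and `S(p) = r'(p,0) r'(p,1)`. The sign `(-1)^{pq}` cancels the
remaining sign in the Galois action on `R(q) S(p)` and gives the value `-1` of the last
condition. -/
theorem exists_units_of_isUnipotentLift (a b c d : Fˣ) {u v v' w w' : AbsGal F → ZMod 2}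
    (H : IsUnipotentLift (kummerFun a) (kummerFun b) (kummerFun c) u v w)
    (H' : IsUnipotentLift (kummerFun b) (kummerFun c) (kummerFun d) v v' w') :
    ∃ (ε : (Biquad (a : F) (c : F))ˣ) (ν : (Biquad (d : F) (b : F))ˣ)
      (ω : (Biquad (b : F) (c : F))ˣ),
      sqClass (normF (a : F) (c : F) ε) = sqClass b ∧
      sqClass (normF (d : F) (b : F) ν) = sqClass c ∧
      inclRight (b : F) (c : F) (normLeft (a : F) (c : F) ε) *
          inclLeft (b : F) (c : F) (normLeft (d : F) (b : F) ν) =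
        (ω : Biquad (b : F) (c : F)) ^ 2 ∧
      subOne (sigmaLeft (b : F) (c : F)) (subOne (sigmaRight (b : F) (c : F)) ω) = -1 := by
  have := neZero_two_separableClosure (F := F)
  obtain ⟨sa, ha, ha0⟩ := exists_sqrt a
  obtain ⟨sb, hb, hb0⟩ := exists_sqrt b
  obtain ⟨sc, hc, hc0⟩ := exists_sqrt c
  obtain ⟨sd, hd, hd0⟩ := exists_sqrt d
  obtain ⟨r, hr0, hr⟩ := H.exists_isRootFamily (K := SeparableClosure F)
    (continuous_kummerFun a) (continuous_kummerFun b) (continuous_kummerFun c)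
    (kummerFun_mul a) (kummerFun_mul b) (kummerFun_mul c)
  obtain ⟨r', hr0', hr'⟩ := H'.exists_isRootFamily (K := SeparableClosure F)
    (continuous_kummerFun b) (continuous_kummerFun c) (continuous_kummerFun d)
    (kummerFun_mul b) (kummerFun_mul c) (kummerFun_mul d)
  obtain ⟨ε, hε⟩ := exists_unit_evalBiquad_eq ha hc ha0 hc0 (apply_sqrt a ha) (apply_sqrt c hc)
    (fun p q => r p q ^ 2) (fun p q => pow_ne_zero 2 (hr0 p q)) hr.apply_sq
  obtain ⟨ν, hν⟩ := exists_unit_evalBiquad_eq hd hb hd0 hb0 (apply_sqrt d hd) (apply_sqrt b hb)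
    (fun p q => r' q p ^ 2) (fun p q => pow_ne_zero 2 (hr0' q p)) fun g p q => hr'.apply_sq g q p
  obtain ⟨ω, hω⟩ := exists_unit_evalBiquad_eq hb hc hb0 hc0 (apply_sqrt b hb) (apply_sqrt c hc)
    (fun p q => sgn _ (p * q) * ((r 0 q * r 1 q) * (r' p 0 * r' p 1)))
    (fun p q => mul_ne_zero (sgn_ne_zero _) (mul_ne_zero (mul_ne_zero (hr0 _ _) (hr0 _ _))
      (mul_ne_zero (hr0' _ _) (hr0' _ _)))) fun g p q => by
        have hsgn : (p + kummerFun b g) * (q + kummerFun c g) +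
            ((v g + (q + kummerFun c g) * kummerFun b g) + (v g + p * kummerFun c g)) = p * q := by
          ring_nf
          reduce_mod_char
        rw [map_mul, map_mul, map_sgn, hr.apply_mul_left, hr'.apply_mul_right, ← hsgn,
          sgn_add (_ * _), sgn_add (v g + _)]
        ring
  refine ⟨ε, ν, ω, (sqClass_eq_iff _ _).2 ⟨_, ?_, hr.apply_prod⟩,
    (sqClass_eq_iff _ _).2 ⟨_, ?_, hr'.apply_prod⟩, ?_, ?_⟩
  · change _ = algebraMap F _ (Algebra.norm F (ε : Biquad (a : F) (c : F)))
    rw [algebraMap_norm_biquad ha hc, hε, hε, hε, hε]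
    ring
  · change _ = algebraMap F _ (Algebra.norm F (ν : Biquad (d : F) (b : F)))
    rw [algebraMap_norm_biquad hd hb, hν, hν, hν, hν]
    ring
  · refine evalBiquad_injective hb hc hb0 hc0 fun p q => ?_
    change evalBiquad hb hc p q (inclRight _ _ (Algebra.norm (Quad (c : F)) ε.val) *
      inclLeft _ _ (Algebra.norm (Quad (b : F)) ν.val)) = _
    rw [map_mul, map_pow, evalBiquad_inclRight, evalBiquad_inclLeft, evalSign_norm ha hc,
      evalSign_norm hd hb, hε, hε, hν, hν, hω, mul_pow, sgn_sq]
    ring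
  · rw [subOne_subOne_eq_neg_one_iff]
    refine evalBiquad_injective hb hc hb0 hc0 fun p q => ?_
    have hsgn : (p + 1) * (q + 1) + p * q = 1 + ((p + 1) * q + p * (q + 1)) := by
      ring
    have hsgn' := congrArg (sgn (SeparableClosure F)) hsgn
    simp only [sgn_add (_ * _), sgn_add 1, sgn_one] at hsgn'
    rw [map_mul, map_neg, map_mul, evalBiquad_sigmaLeft, evalBiquad_sigmaRight,
      evalBiquad_sigmaLeft, evalBiquad_sigmaRight, hω, hω, hω, hω]
    linear_combination ((r 0 (q + 1) * r 1 (q + 1)) * (r' (p + 1) 0 * r' (p + 1) 1)) *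
      ((r 0 q * r 1 q) * (r' p 0 * r' p 1)) * hsgn'

/-- Square roots of `ε` and `ν` give lifts of the two triples of characters. Comparison with `ω`
shows that their common entries differ by a combination of the characters of `b` and `c`, which is
then removed by conjugating the second lift. -/
theorem exists_isUnipotentLift_of_units (a b c d : Fˣ) (ε : (Biquad (a : F) (c : F))ˣ)
    (ν : (Biquad (d : F) (b : F))ˣ) (ω : (Biquad (b : F) (c : F))ˣ)
    (hε : sqClass (normF (a : F) (c : F) ε) = sqClass b)
    (hν : sqClass (normF (d : F) (b : F) ν) = sqClass c)
    (hω : inclRight (b : F) (c : F) (normLeft (a : F) (c : F) ε) *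
        inclLeft (b : F) (c : F) (normLeft (d : F) (b : F) ν) =
      (ω : Biquad (b : F) (c : F)) ^ 2)
    (hσ : subOne (sigmaLeft (b : F) (c : F)) (subOne (sigmaRight (b : F) (c : F)) ω) = -1) :
    ∃ u v v' w w' : AbsGal F → ZMod 2,
      IsUnipotentLift (kummerFun a) (kummerFun b) (kummerFun c) u v w ∧
      IsUnipotentLift (kummerFun b) (kummerFun c) (kummerFun d) v v' w' := by
  have := neZero_two_separableClosure (F := F)
  obtain ⟨sa, ha, ha0⟩ := exists_sqrt a
  obtain ⟨sb, hb, hb0⟩ := exists_sqrt b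
  obtain ⟨sc, hc, hc0⟩ := exists_sqrt c
  obtain ⟨sd, hd, hd0⟩ := exists_sqrt d
  have hroot : ∀ x : SeparableClosure F, ∃ y, y ^ 2 = x := fun x => by
    obtain ⟨y, hy⟩ := IsSepClosed.exists_eq_mul_self x
    exact ⟨y, by rw [sq, hy]⟩
  choose r hr using fun p q => hroot (evalBiquad ha hc p q ε)
  choose r' hr' using fun p q => hroot (evalBiquad hd hb q p ν)
  have hr0 : ∀ p q, r p q ≠ 0 := fun p q =>
    (pow_ne_zero_iff two_ne_zero).1 (by rw [hr]; exact (ε.isUnit.map _).ne_zero)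
  have hr0' : ∀ p q, r' p q ≠ 0 := fun p q =>
    (pow_ne_zero_iff two_ne_zero).1 (by rw [hr']; exact (ν.isUnit.map _).ne_zero)
  obtain ⟨m, hm, hmg⟩ := (sqClass_eq_iff _ _).1 hε
  obtain ⟨m', hm', hmg'⟩ := (sqClass_eq_iff _ _).1 hν
  change _ = algebraMap F _ (Algebra.norm F (ε : Biquad (a : F) (c : F))) at hm
  change _ = algebraMap F _ (Algebra.norm F (ν : Biquad (d : F) (b : F))) at hm'
  rw [algebraMap_norm_biquad ha hc, ← hr, ← hr, ← hr, ← hr] at hm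
  rw [algebraMap_norm_biquad hd hb, ← hr', ← hr', ← hr', ← hr'] at hm'
  obtain ⟨t, ht⟩ := exists_eq_sgn_mul_of_sq_eq
    (show (r 0 0 * r 0 1 * r 1 0 * r 1 1) ^ 2 = m ^ 2 by rw [hm]; ring)
  obtain ⟨t', ht'⟩ := exists_eq_sgn_mul_of_sq_eq
    (show (r' 0 0 * r' 0 1 * r' 1 0 * r' 1 1) ^ 2 = m' ^ 2 by rw [hm']; ring)
  obtain ⟨u, v, w, H, hrf⟩ := exists_isUnipotentLift_of_sq (continuous_kummerFun a)
    (continuous_kummerFun b) (continuous_kummerFun c) (kummerFun_mul a) (kummerFun_mul b)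
    (kummerFun_mul c) hr0
    (fun g p q => by
      rw [hr, hr]; exact apply_evalBiquad ha hc g (apply_sqrt a ha g) (apply_sqrt c hc g) p q _)
    (fun g => by rw [ht, map_mul, map_sgn, hmg, mul_left_comm])
  obtain ⟨v₂, v', w', H', hrf'⟩ := exists_isUnipotentLift_of_sq (continuous_kummerFun b)
    (continuous_kummerFun c) (continuous_kummerFun d) (kummerFun_mul b) (kummerFun_mul c)
    (kummerFun_mul d) hr0'
    (fun g p q => by
      rw [hr', hr']; exact apply_evalBiquad hd hb g (apply_sqrt d hd g) (apply_sqrt b hb g) q p _)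
    (fun g => by rw [ht', map_mul, map_sgn, hmg', mul_left_comm])
  -- `η` measures the difference between the chosen square roots and `ω`.
  have hη : ∀ p q, ∃ t, (r 0 q * r 1 q) * (r' p 0 * r' p 1) =
      sgn _ t * evalBiquad hb hc p q ω := fun p q => exists_eq_sgn_mul_of_sq_eq (by
    rw [← map_pow, ← hω]
    change _ = evalBiquad hb hc p q (inclRight _ _ (Algebra.norm (Quad (c : F)) ε.val) *
      inclLeft _ _ (Algebra.norm (Quad (b : F)) ν.val))
    rw [map_mul, evalBiquad_inclRight, evalBiquad_inclLeft, evalSign_norm ha hc,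
      evalSign_norm hd hb, ← hr, ← hr, ← hr', ← hr']
    ring)
  choose η hη using hη
  have hω0 : ∀ p q, evalBiquad hb hc p q (ω : Biquad (b : F) (c : F)) ≠ 0 := fun p q =>
    (ω.isUnit.map _).ne_zero
  -- The condition on `ω` says that `η` is a quadratic polynomial with leading term `p * q`.
  have hηsum : η 0 0 + η 1 1 = 1 + (η 1 0 + η 0 1) := by
    apply sgn_injective (K := SeparableClosure F)
    have h := congrArg (evalBiquad hb hc 0 0) ((subOne_subOne_eq_neg_one_iff _ _ _).1 hσ)
    rw [map_mul, map_neg, map_mul, evalBiquad_sigmaLeft, evalBiquad_sigmaRight,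
      evalBiquad_sigmaLeft, evalBiquad_sigmaRight, zero_add] at h
    apply mul_right_cancel₀ (mul_ne_zero (hω0 1 1) (hω0 0 0))
    simp only [sgn_add, sgn_one]
    linear_combination sgn _ (η 1 0) * sgn _ (η 0 1) * h -
      sgn _ (η 1 1) * evalBiquad hb hc 1 1 ω * hη 0 0 - (r 0 0 * r 1 0) * (r' 0 0 * r' 0 1) * hη 1 1
      + sgn _ (η 0 1) * evalBiquad hb hc 0 1 ω * hη 1 0
      + (r 0 0 * r 1 0) * (r' 1 0 * r' 1 1) * hη 0 1
  have hηpoly : ∀ p q, η p q = η 0 0 + p * (η 1 0 + η 0 0) + q * (η 0 1 + η 0 0) + p * q := by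
    intro p q
    rcases eq_zero_or_one p with rfl | rfl <;> rcases eq_zero_or_one q with rfl | rfl
    · ring
    · linear_combination (norm := (ring_nf; try reduce_mod_char))
    · linear_combination (norm := (ring_nf; try reduce_mod_char))
    · linear_combination (norm := (ring_nf; try reduce_mod_char)) hηsum
  have hv : ∀ g, v g = v₂ g + (η 1 0 + η 0 0) * kummerFun b g +
      (η 0 1 + η 0 0) * kummerFun c g := fun g => by
    have hkey : η (0 + kummerFun b g) (0 + kummerFun c g) =
        (v g + (0 + kummerFun c g) * kummerFun b g) + (v₂ g + 0 * kummerFun c g) + η 0 0 := by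
      apply sgn_injective (K := SeparableClosure F)
      apply mul_right_cancel₀ (hω0 0 0)
      have h := congrArg g (hη (0 + kummerFun b g) (0 + kummerFun c g))
      rw [map_mul, hrf.apply_mul_left, hrf'.apply_mul_right, map_mul, map_sgn,
        apply_evalBiquad hb hc g (apply_sqrt b hb g) (apply_sqrt c hc g)] at h
      rw [← h, sgn_add _ (η 0 0), mul_assoc _ (sgn _ (η 0 0)), ← hη, sgn_add (v g + _)]
      ring
    rw [hηpoly (0 + _)] at hkey
    linear_combination (norm := (ring_nf; try reduce_mod_char)) hkey
  obtain rfl : v = fun g => v₂ g + (η 1 0 + η 0 0) * kummerFun b g +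
      (η 0 1 + η 0 0) * kummerFun c g := funext hv
  exact ⟨u, _, _, w, _, H, H'.add_characters (continuous_kummerFun b) (continuous_kummerFun c)
    (continuous_kummerFun d) (kummerFun_mul b) (kummerFun_mul c) (kummerFun_mul d) _ _⟩

end Main

end MasseyProd

theorem proposition3p5 {F : Type*} [Field F] [NeZero (2 : F)] (a b c d : Fˣ) :
    (MasseyProd.masseyProduct₄ a b c d).Nonempty ↔
      ∃ (ε : (MasseyProd.Biquad (a : F) (c : F))ˣ) (ν : (MasseyProd.Biquad (d : F) (b : F))ˣ)
        (ω : (MasseyProd.Biquad (b : F) (c : F))ˣ),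
        MasseyProd.sqClass (MasseyProd.normF (a : F) (c : F) ε) = MasseyProd.sqClass b ∧
        MasseyProd.sqClass (MasseyProd.normF (d : F) (b : F) ν) = MasseyProd.sqClass c ∧
        MasseyProd.inclRight (b : F) (c : F) (MasseyProd.normLeft (a : F) (c : F) ε) *
            MasseyProd.inclLeft (b : F) (c : F) (MasseyProd.normLeft (d : F) (b : F) ν) =
          (ω : MasseyProd.Biquad (b : F) (c : F)) ^ 2 ∧
        MasseyProd.subOne (MasseyProd.sigmaLeft (b : F) (c : F))
            (MasseyProd.subOne (MasseyProd.sigmaRight (b : F) (c : F)) ω) = -1 := by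

  rw [MasseyProd.masseyProduct₄_nonempty_iff]
  constructor
  · rintro ⟨u, v, v', w, w', H, H'⟩
    exact MasseyProd.exists_units_of_isUnipotentLift a b c d H H'
  · rintro ⟨ε, ν, ω, hε, hν, hω, hσ⟩
    exact MasseyProd.exists_isUnipotentLift_of_units a b c d ε ν ω hε hν hω hσ
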